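/- Let $\Gamma$ be a connected finite metric graph: finitely many compact edges $E_n=[0,\ell_n]$, $\ell_n>0$, glued together at vertices, which are the classes of a partition of the set of all edge end points (loops and multiple edges are allowed). The standard Laplacian $L^{\mathrm{st}}(\Gamma)=-\frac{d^2}{dx^2}$ acts in $L_2(\Gamma)=\bigoplus_n L_2(E_n)$ on the functions in $\bigoplus_n W_2^2(E_n)$ that are continuous at every vertex and whose normal derivatives at every vertex sum to zero. Its spectrum is discrete; let $0=\lambda_0(\Gamma)\le\lambda_1(\Gamma)\le\lambda_2(\Gamma)\le\dots$ be its eigenvalues, counted with multiplicity. Let $V_1,V_2$ be vertices of $\Gamma$ and let $\Gamma'$ be the metric graph obtained from $\Gamma$ by adding an edge of some length $\ell\in(0,\infty)$ between $V_1$ and $V_2$. Assume that an eigenfunction $\psi_1$ of $L^{\mathrm{st}}(\Gamma)$ corresponding to the eigenvalue $\lambda_1(\Gamma)$ can be chosen such that $$\psi_1(V_1)=\psi_1(V_2).$$ Then $$\lambda_1(\Gamma)\ge\lambda_1(\Gamma').$$ -/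

import Mathlib

open MeasureTheory

/-- A finite metric graph with vertex set `V` and edge set `E`.  The edge `e` is a compact interval
`[0, length e]` of positive length; its end point `0` belongs to the vertex `start e` and its end
point `length e` to the vertex `finish e`.  Loops and parallel edges are allowed.  The vertices are
the classes of a partition of the set of all end points, so each of them contains an end point. -/
structure MetricGraph (V E : Type*) [Fintype E] where
  length : E → ℝ
  length_pos : ∀ e, 0 < length e
  start : E → V
  finish : E → V
  exists_edge : ∀ v, ∃ e, start e = v ∨ finish e = v

/-- `f` is (the continuous representative of) an element of the Sobolev space `W_2^1(0, ℓ)`, and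
`f'` is its weak derivative: `f` is absolutely continuous on `[0, ℓ]` with derivative
`f' ∈ L_2(0, ℓ)`. -/
def HasSobolevDeriv {𝕜 : Type*} [RCLike 𝕜] (ℓ : ℝ) (f f' : ℝ → 𝕜) : Prop :=
  MemLp f' 2 (volume.restrict (Set.Icc 0 ℓ)) ∧
    ∀ x ∈ Set.Icc 0 ℓ, f x = f 0 + ∫ t in (0 : ℝ)..x, f' t

namespace MetricGraph

variable {𝕜 : Type*} [RCLike 𝕜] {V E : Type*} [Fintype E]

/-- The metric graph is connected: any two vertices are joined by a chain of edges (and there is at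
least one vertex). -/
def Connected (Γ : MetricGraph V E) : Prop :=
  (SimpleGraph.fromRel fun v w => ∃ e, Γ.start e = v ∧ Γ.finish e = w).Connected

/-- The metric graph obtained by adding an edge of length `ℓ` between the vertices `V₁`, `V₂`.
The new edge is `none`. -/
noncomputable def addEdge (Γ : MetricGraph V E) (V₁ V₂ : V) (ℓ : ℝ) (hℓ : 0 < ℓ) : MetricGraph V (Option E) where
  length := fun o => o.elim ℓ Γ.length
  length_pos := by
    rintro (_ | e)
    · exact hℓ
    · exact Γ.length_pos e
  start := fun o => o.elim V₁ Γ.start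
  finish := fun o => o.elim V₂ Γ.finish
  exists_edge := fun v => by
    obtain ⟨e, he⟩ := Γ.exists_edge v
    exact ⟨some e, he⟩

/-- `𝕜`-valued functions on the disjoint union of the edges. -/
abbrev EdgeFun (𝕜 : Type*) (Γ : MetricGraph V E) : Type _ :=
  (e : E) → Set.Icc (0 : ℝ) (Γ.length e) → 𝕜

/-- The restriction of `u` to the edge `e`, as a function of a real variable; its values outside
`[0, length e]` (the nearest end point value) play no role. -/
noncomputable def onEdge (Γ : MetricGraph V E) (u : Γ.EdgeFun 𝕜) (e : E) : ℝ → 𝕜 :=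
  Set.IccExtend (Γ.length_pos e).le (u e)

/-- All end points that belong to the vertex `v` carry the value `c` of `u`: the function `u` is
continuous at `v`, with `u v = c`. -/
def HasValueAt (Γ : MetricGraph V E) (u : Γ.EdgeFun 𝕜) (v : V) (c : 𝕜) : Prop :=
  (∀ e, Γ.start e = v → Γ.onEdge u e 0 = c) ∧
    ∀ e, Γ.finish e = v → Γ.onEdge u e (Γ.length e) = c

open Classical in
/-- The function `u` belongs to the domain of the standard Laplacian `L = -d²/dx²`, with first and
second weak derivatives `u'` and `u''`: it is in `W_2^2` on every edge, it is continuous at every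
vertex, and at every vertex the sum of the normal derivatives, taken along the edges away from the
vertex, is zero. -/
structure InLaplacianDomain (Γ : MetricGraph V E) (u : Γ.EdgeFun 𝕜) (u' u'' : E → ℝ → 𝕜) :
    Prop where
  deriv_one : ∀ e, HasSobolevDeriv (Γ.length e) (Γ.onEdge u e) (u' e)
  deriv_two : ∀ e, HasSobolevDeriv (Γ.length e) (u' e) (u'' e)
  continuous : ∀ v, ∃ c, Γ.HasValueAt u v c
  kirchhoff : ∀ v, ∑ e with Γ.start e = v, u' e 0
    - ∑ e with Γ.finish e = v, u' e (Γ.length e) = 0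

/-- `u` is an eigenfunction of the standard Laplacian with eigenvalue `lam`: it is a nonzero
element of the domain, and `-u'' = lam u` in `L_2` of the graph. -/
def IsEigenfunction (Γ : MetricGraph V E) (lam : ℝ) (u : Γ.EdgeFun 𝕜) : Prop :=
  u ≠ 0 ∧ ∃ u' u'' : E → ℝ → 𝕜, Γ.InLaplacianDomain u u' u'' ∧
    ∀ e, ∀ᵐ x ∂(volume.restrict (Set.Icc 0 (Γ.length e))), -u'' e x = (lam : 𝕜) * Γ.onEdge u e x

/-- The span of all eigenfunctions whose eigenvalues lie in `s`. -/
def spectralSpan (𝕜 : Type*) [RCLike 𝕜] (Γ : MetricGraph V E) (s : Set ℝ) :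
    Submodule 𝕜 (Γ.EdgeFun 𝕜) :=
  Submodule.span 𝕜 {u | ∃ μ ∈ s, Γ.IsEigenfunction μ u}

/-- `lam` is the eigenvalue `λ_n` of the standard Laplacian, in the enumeration
`λ_0 ≤ λ_1 ≤ λ_2 ≤ …` of the eigenvalues with multiplicities: at most `n` linearly independent
eigenfunctions have eigenvalue `< lam`, and more than `n` have eigenvalue `≤ lam`. -/
def IsNthEigenvalue (𝕜 : Type*) [RCLike 𝕜] (Γ : MetricGraph V E) (n : ℕ) (lam : ℝ) : Prop :=
  Module.rank 𝕜 (Γ.spectralSpan 𝕜 (Set.Iio lam)) ≤ n ∧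
    n < Module.rank 𝕜 (Γ.spectralSpan 𝕜 (Set.Iic lam))

/-- There is at most one `n`-th eigenvalue. -/
theorem IsNthEigenvalue.unique {Γ : MetricGraph V E} {n : ℕ} {a b : ℝ}
    (ha : Γ.IsNthEigenvalue 𝕜 n a) (hb : Γ.IsNthEigenvalue 𝕜 n b) : a = b := by
  have key : ∀ {a b : ℝ}, Γ.IsNthEigenvalue 𝕜 n a → Γ.IsNthEigenvalue 𝕜 n b → ¬ a < b := by
    intro a b ha hb hab
    have h : Γ.spectralSpan 𝕜 (Set.Iic a) ≤ Γ.spectralSpan 𝕜 (Set.Iio b) :=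
      Submodule.span_mono fun u ⟨μ, hμ, hu⟩ => ⟨μ, lt_of_le_of_lt hμ hab, hu⟩
    exact absurd (ha.2.trans_le ((Submodule.rank_mono h).trans hb.1)) (lt_irrefl _)
  exact le_antisymm (not_lt.1 (key hb ha)) (not_lt.1 (key ha hb))

end MetricGraph

/-! The comparison is a test function argument for the Rayleigh quotient. Since `ψ₁` takes the same
value at both vertices, it extends to the new edge by that constant, remaining in the Sobolev space
without gaining energy. Subtracting its mean over `Γ'` gives an admissible test function. As `ψ₁`
has mean zero on `Γ`, subtracting a constant cannot decrease its norm there, and the new edge only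
adds to the norm. Hence the quotient on `Γ'` is at most `lam₁`.

The longer part is that the minimum of the quotient over mean-zero functions exists and is the
eigenvalue of index one on a connected graph. The gradients (weak derivatives of Sobolev functions)
form a closed subspace of `L2`, and the operator `meanZeroPrimitive` sends a gradient to its
primitive of mean zero. It is compact, being a finite-rank operator plus Volterra operators on the
edges, between projections. Its squared norm `M` is the best constant in the Poincaré inequality
`‖u‖² ≤ M‖u'‖²`, and compactness makes it attain its norm
(`IsCompactOperator.exists_inner_apply_eq_norm_sq_mul`). The Euler-Lagrange equation at a maximizer
is the weak eigenvalue equation with eigenvalue `M⁻¹`; `IsSobolev.exists_deriv_two` turns weak into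
strong solutions, Kirchhoff's condition included. By the Poincaré inequality, no nonconstant
eigenfunction has an eigenvalue below `M⁻¹` (`isNthEigenvalue_one_of_minimizer`). -/

open Set Filter Topology in
/-- A primitive of an integrable vector-valued function is absolutely continuous. -/
theorem IntervalIntegrable.absolutelyContinuousOnInterval_primitive {F : Type*}
    [NormedAddCommGroup F] [NormedSpace ℝ F] {f : ℝ → F} {a b c : ℝ}
    (h : IntervalIntegrable f volume a b) (hc : c ∈ uIcc a b) :
    AbsolutelyContinuousOnInterval (fun x ↦ ∫ v in c..x, f v) a b := by
  have hn := h.norm.absolutelyContinuousOnInterval_intervalIntegral hc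
  refine squeeze_zero' (.of_forall fun _ ↦ Finset.sum_nonneg fun _ _ ↦ dist_nonneg) ?_ hn
  have hev : ∀ᶠ (I : ℕ × (ℕ → ℝ × ℝ)) in AbsolutelyContinuousOnInterval.totalLengthFilter ⊓
      𝓟 (AbsolutelyContinuousOnInterval.disjWithin a b),
      I ∈ AbsolutelyContinuousOnInterval.disjWithin a b :=
    eventually_inf_principal.mpr (by simp)
  filter_upwards [hev] with I hI
  refine Finset.sum_le_sum fun i hi ↦ ?_
  obtain ⟨h1, h2⟩ := hI.1 i hi
  have key : ∀ x ∈ uIcc a b, IntervalIntegrable f volume c x := fun x hx ↦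
    h.mono_set (uIcc_subset_uIcc hc hx)
  rw [dist_eq_norm, dist_eq_norm,
    intervalIntegral.integral_interval_sub_left (key _ h1) (key _ h2),
    intervalIntegral.integral_interval_sub_left (key _ h1).norm (key _ h2).norm]
  exact intervalIntegral.norm_integral_le_abs_integral_norm

/-! ### Sobolev functions on an interval and integration by parts -/

section Interval

variable {𝕜 : Type*} [RCLike 𝕜] {ℓ : ℝ}

theorem ContinuousOn.memLp_restrict_Icc {f : ℝ → 𝕜} {a b : ℝ}
    (hf : ContinuousOn f (Set.Icc a b)) (p : ENNReal) :
    MemLp f p (volume.restrict (Set.Icc a b)) := by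
  obtain ⟨C, hC⟩ := isCompact_Icc.exists_bound_of_continuousOn hf
  exact MemLp.of_bound (hf.aestronglyMeasurable measurableSet_Icc) C
    ((ae_restrict_iff' measurableSet_Icc).2 (.of_forall hC))

theorem MeasureTheory.MemLp.intervalIntegrable_Icc {f : ℝ → 𝕜} (hℓ : 0 ≤ ℓ)
    (hf : MemLp f 2 (volume.restrict (Set.Icc 0 ℓ))) : IntervalIntegrable f volume 0 ℓ := by
  rw [intervalIntegrable_iff_integrableOn_Icc_of_le hℓ]
  exact hf.integrable (by norm_num)

theorem intervalIntegral_eq_integral_Icc {f : ℝ → 𝕜} (hℓ : 0 ≤ ℓ) :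
    ∫ t in (0 : ℝ)..ℓ, f t = ∫ t in Set.Icc 0 ℓ, f t := by
  rw [intervalIntegral.integral_of_le hℓ, integral_Icc_eq_integral_Ioc]

namespace HasSobolevDeriv

variable {f f' g g' : ℝ → 𝕜}

theorem intervalIntegrable (hℓ : 0 ≤ ℓ) (hf : HasSobolevDeriv ℓ f f') :
    IntervalIntegrable f' volume 0 ℓ :=
  hf.1.intervalIntegrable_Icc hℓ

theorem primitive (hf : MemLp f' 2 (volume.restrict (Set.Icc 0 ℓ))) (a : 𝕜) :
    HasSobolevDeriv ℓ (fun x ↦ a + ∫ t in (0 : ℝ)..x, f' t) f' :=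
  ⟨hf, fun x _ ↦ by simp⟩

theorem congr (hf : HasSobolevDeriv ℓ f f') (hℓ : 0 ≤ ℓ) (h : Set.EqOn g f (Set.Icc 0 ℓ))
    (h' : g' =ᵐ[volume.restrict (Set.Icc 0 ℓ)] f') : HasSobolevDeriv ℓ g g' := by
  refine ⟨hf.1.ae_eq h'.symm, fun x hx ↦ ?_⟩
  rw [h hx, h ⟨le_rfl, hℓ⟩, hf.2 x hx]
  congr 1
  refine intervalIntegral.integral_congr_ae ?_
  rw [Filter.EventuallyEq, ae_restrict_iff' measurableSet_Icc] at h'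
  filter_upwards [h'] with t ht htx
  rw [Set.uIoc_of_le hx.1] at htx
  exact (ht ⟨htx.1.le, htx.2.trans hx.2⟩).symm

theorem absolutelyContinuousOnInterval (hℓ : 0 ≤ ℓ) (hf : HasSobolevDeriv ℓ f f') :
    AbsolutelyContinuousOnInterval (fun x ↦ f 0 + ∫ t in (0 : ℝ)..x, f' t) 0 ℓ := by
  have h1 := (hf.intervalIntegrable hℓ).absolutelyContinuousOnInterval_primitive
    (c := 0) (by simp)
  have h2 : AbsolutelyContinuousOnInterval (fun _ : ℝ ↦ f 0) 0 ℓ :=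
    (LipschitzWith.const (f 0)).lipschitzOnWith.absolutelyContinuousOnInterval
  exact h2.add h1

theorem continuousOn (hℓ : 0 ≤ ℓ) (hf : HasSobolevDeriv ℓ f f') :
    ContinuousOn f (Set.Icc 0 ℓ) := by
  have := (hf.absolutelyContinuousOnInterval hℓ).continuousOn
  rw [Set.uIcc_of_le hℓ] at this
  exact this.congr hf.2

theorem memLp (hℓ : 0 ≤ ℓ) (hf : HasSobolevDeriv ℓ f f') :
    MemLp f 2 (volume.restrict (Set.Icc 0 ℓ)) :=
  (hf.continuousOn hℓ).memLp_restrict_Icc 2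

/-- Lebesgue differentiation. It concerns the primitive because `f` itself is unconstrained outside
`[0, ℓ]`. -/
theorem ae_hasDerivAt (hℓ : 0 ≤ ℓ) (hf : HasSobolevDeriv ℓ f f') :
    ∀ᵐ x, x ∈ Set.Icc 0 ℓ → HasDerivAt (fun x ↦ f 0 + ∫ t in (0 : ℝ)..x, f' t) (f' x) x := by
  filter_upwards [(hf.intervalIntegrable hℓ).ae_hasDerivAt_integral] with x hx hx'
  rw [Set.uIcc_of_le hℓ] at hx
  exact (hx hx' 0 ⟨le_rfl, hℓ⟩).const_add _

theorem const (a : 𝕜) : HasSobolevDeriv ℓ (fun _ ↦ a) (fun _ ↦ (0 : 𝕜)) :=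
  ⟨MemLp.zero', fun x _ ↦ by simp⟩

theorem const_mul (hf : HasSobolevDeriv ℓ f f') (a : 𝕜) :
    HasSobolevDeriv ℓ (fun x ↦ a * f x) (fun x ↦ a * f' x) := by
  refine ⟨hf.1.const_mul a, fun x hx ↦ ?_⟩
  beta_reduce
  rw [hf.2 x hx, intervalIntegral.integral_const_mul, mul_add]

theorem star (hf : HasSobolevDeriv ℓ f f') :
    HasSobolevDeriv ℓ (fun x ↦ (starRingEnd 𝕜) (f x)) (fun x ↦ (starRingEnd 𝕜) (f' x)) := by
  refine ⟨hf.1.star, fun x hx ↦ ?_⟩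
  beta_reduce
  rw [hf.2 x hx, map_add, intervalIntegral.intervalIntegral_conj]

theorem sub_const (hf : HasSobolevDeriv ℓ f f') (a : 𝕜) :
    HasSobolevDeriv ℓ (fun x ↦ f x - a) f' := by
  refine ⟨hf.1, fun x hx ↦ ?_⟩
  beta_reduce
  rw [hf.2 x hx]; ring

/-- Integration by parts for functions in `W_2^1`. -/
theorem integral_mul_add_mul (hℓ : 0 ≤ ℓ) (hf : HasSobolevDeriv ℓ f f')
    (hg : HasSobolevDeriv ℓ g g') :
    ∫ x in Set.Icc 0 ℓ, (f' x * g x + f x * g' x) = f ℓ * g ℓ - f 0 * g 0 := by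
  have hacf := hf.absolutelyContinuousOnInterval hℓ
  have hacg := hg.absolutelyContinuousOnInterval hℓ
  have hint : IntervalIntegrable (fun x ↦ f' x * g x + f x * g' x) volume 0 ℓ := by
    have h1 := hf.continuousOn hℓ
    have h2 := hg.continuousOn hℓ
    rw [← Set.uIcc_of_le hℓ] at h1 h2
    exact ((hf.intervalIntegrable hℓ).mul_continuousOn h2).add
      ((hg.intervalIntegrable hℓ).continuousOn_mul h1)
  -- The product minus the primitive of its formal derivative is absolutely continuous with
  -- derivative zero almost everywhere, hence constant; its values at `0` and `ℓ` are then compared.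
  have hac := (hacf.smul hacg).sub
    (hint.absolutelyContinuousOnInterval_primitive (c := 0) (by simp))
  obtain ⟨C, hC⟩ := hac.const_of_ae_hasDerivAt_zero (by
    filter_upwards [hf.ae_hasDerivAt hℓ, hg.ae_hasDerivAt hℓ, hint.ae_hasDerivAt_integral]
      with x h1 h2 h3 hx
    have h3 := h3 hx 0 (by simp)
    rw [Set.uIcc_of_le hℓ] at hx
    refine (((h1 hx).mul (h2 hx)).sub h3).congr_deriv ?_
    rw [← hf.2 x hx, ← hg.2 x hx, sub_self])
  have h0 := hC 0 (by simp)
  have h1 := hC ℓ (by simp)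
  simp only [Pi.sub_apply, smul_eq_mul, Pi.mul_apply] at h0 h1
  rw [← hf.2 ℓ ⟨hℓ, le_rfl⟩, ← hg.2 ℓ ⟨hℓ, le_rfl⟩, intervalIntegral_eq_integral_Icc hℓ] at h1
  simp only [intervalIntegral.integral_same, add_zero, sub_zero] at h0
  rw [h0, ← h1]; ring

/-- Integration by parts for functions in `W_2^1`, in terms of inner products. -/
theorem integral_inner_deriv (hℓ : 0 ≤ ℓ) (hf : HasSobolevDeriv ℓ f f')
    (hg : HasSobolevDeriv ℓ g g') :
    ∫ x in Set.Icc 0 ℓ, inner 𝕜 (f x) (g' x) =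
      inner 𝕜 (f ℓ) (g ℓ) - inner 𝕜 (f 0) (g 0) - ∫ x in Set.Icc 0 ℓ, inner 𝕜 (f' x) (g x) := by
  have h := integral_mul_add_mul hℓ hg hf.star
  rw [integral_add] at h
  · simp only [RCLike.inner_apply]
    rw [← h]; ring
  · exact hg.1.integrable_mul (hf.memLp hℓ).star
  · exact (hg.memLp hℓ).integrable_mul hf.1.star

end HasSobolevDeriv

end Interval

/-! ### Compact operators: norm attainment and operators with continuous kernels -/

section CompactOperator

variable {𝕜 : Type*} [RCLike 𝕜]

open Filter Topology in
/-- A compact operator between Hilbert spaces attains its norm, and at a maximizer the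
Euler-Lagrange equation holds. -/
theorem IsCompactOperator.exists_inner_apply_eq_norm_sq_mul {H H' : Type*}
    [NormedAddCommGroup H] [InnerProductSpace 𝕜 H] [CompleteSpace H]
    [NormedAddCommGroup H'] [InnerProductSpace 𝕜 H'] [CompleteSpace H']
    (K : H →L[𝕜] H') (hK : IsCompactOperator K) (hK0 : K ≠ 0) :
    ∃ g ≠ 0, ∀ h, inner 𝕜 (K h) (K g) = ((‖K‖ ^ 2 : ℝ) : 𝕜) * inner 𝕜 h g := by
  set M := ‖K‖ with hM
  have hM0 : 0 < M := norm_pos_iff.2 hK0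
  set S : H →L[𝕜] H := K.adjoint ∘L K with hS
  have hSc : IsCompactOperator S := hK.clm_comp K.adjoint
  have hx : ∀ n : ℕ, ∃ x : H, ‖x‖ < 1 ∧ M - 1 / ((n : ℝ) + 1) < ‖K x‖ := fun n ↦
    K.exists_lt_apply_of_lt_opNorm (by have : 0 < 1 / ((n : ℝ) + 1) := by positivity
                                       linarith)
  choose x hx1 hx2 using hx
  have hKle : ∀ n, ‖K (x n)‖ ≤ M := fun n ↦ by
    have := K.le_opNorm (x n)
    nlinarith [hx1 n]
  have hlim : Tendsto (fun n ↦ ‖K (x n)‖) atTop (𝓝 M) := by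
    refine tendsto_of_tendsto_of_tendsto_of_le_of_le ?_ tendsto_const_nhds
      (fun n ↦ (hx2 n).le) hKle
    simpa using tendsto_const_nhds.sub (tendsto_one_div_add_atTop_nhds_zero_nat (𝕜 := ℝ))
  -- Expanding the square shows that near-maximizers of `‖K x‖` are approximate eigenvectors of `S`
  -- for `M ^ 2`.
  have hbound : ∀ n, ‖S (x n) - ((M ^ 2 : ℝ) : 𝕜) • x n‖ ^ 2
      ≤ 2 * M ^ 2 * (M ^ 2 - ‖K (x n)‖ ^ 2) := fun n ↦ by
    have h1 : ‖S (x n)‖ ≤ M * ‖K (x n)‖ := by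
      simpa [hS, hM] using K.adjoint.le_opNorm (K (x n))
    have h2 : RCLike.re (inner 𝕜 (S (x n)) (((M ^ 2 : ℝ) : 𝕜) • x n)) = M ^ 2 * ‖K (x n)‖ ^ 2 := by
      rw [inner_smul_right, hS, ContinuousLinearMap.comp_apply,
        ContinuousLinearMap.adjoint_inner_left, RCLike.re_ofReal_mul, inner_self_eq_norm_sq]
    have h3 : ‖((M ^ 2 : ℝ) : 𝕜) • x n‖ ≤ M ^ 2 := by
      rw [norm_smul, RCLike.norm_ofReal, abs_of_pos (by positivity)]
      nlinarith [hx1 n, sq_nonneg M]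
    have h4 : M * ‖K (x n)‖ ≤ M ^ 2 := by nlinarith [hKle n]
    rw [norm_sub_sq (𝕜 := 𝕜), h2]
    have h5 : ‖S (x n)‖ ^ 2 ≤ (M ^ 2) ^ 2 := by gcongr; exact h1.trans h4
    have h6 : ‖((M ^ 2 : ℝ) : 𝕜) • x n‖ ^ 2 ≤ (M ^ 2) ^ 2 := by gcongr
    linarith
  have hdiff : Tendsto (fun n ↦ S (x n) - ((M ^ 2 : ℝ) : 𝕜) • x n) atTop (𝓝 0) := by
    rw [tendsto_zero_iff_norm_tendsto_zero]
    have h1 : Tendsto (fun n ↦ 2 * M ^ 2 * (M ^ 2 - ‖K (x n)‖ ^ 2)) atTop (𝓝 0) := by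
      have h := ((tendsto_const_nhds (x := M ^ 2)).sub (hlim.pow 2)).const_mul (2 * M ^ 2)
      rwa [sub_self, mul_zero] at h
    have h2 := (squeeze_zero (fun n ↦ sq_nonneg _) hbound h1).sqrt
    simpa using h2
  obtain ⟨C, hC, hCS⟩ := hSc.image_closedBall_subset_compact (f := S.toLinearMap) 1
  obtain ⟨y, -, φ, hφ, hy⟩ := hC.tendsto_subseq (x := fun n ↦ S (x n))
    (fun n ↦ hCS ⟨x n, by simpa using (hx1 n).le, rfl⟩)
  have hM' : ((M ^ 2 : ℝ) : 𝕜) ≠ 0 := by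
    rw [Ne, RCLike.ofReal_eq_zero]; positivity
  -- Along the subsequence `S x → y` and `S x - M² x → 0`, so `x` itself converges, to `M⁻² y`.
  set g : H := ((M ^ 2 : ℝ) : 𝕜)⁻¹ • y with hg
  have hxg : Tendsto (fun n ↦ x (φ n)) atTop (𝓝 g) := by
    have h1 := (hy.sub (hdiff.comp hφ.tendsto_atTop)).const_smul (((M ^ 2 : ℝ) : 𝕜)⁻¹)
    refine (h1.congr fun n ↦ ?_).trans_eq (by rw [sub_zero])
    simp only [Function.comp_apply, sub_sub_cancel]
    rw [smul_smul, inv_mul_cancel₀ hM', one_smul]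
  have hKg : ‖K g‖ = M :=
    tendsto_nhds_unique ((K.continuous.tendsto g).comp hxg).norm (hlim.comp hφ.tendsto_atTop)
  have hSg : S g = ((M ^ 2 : ℝ) : 𝕜) • g := by
    have h1 : Tendsto (fun n ↦ S (x (φ n)) - ((M ^ 2 : ℝ) : 𝕜) • x (φ n)) atTop
        (𝓝 (S g - ((M ^ 2 : ℝ) : 𝕜) • g)) :=
      ((S.continuous.tendsto g).comp hxg).sub (hxg.const_smul _)
    exact sub_eq_zero.1 (tendsto_nhds_unique h1 (hdiff.comp hφ.tendsto_atTop))
  refine ⟨g, fun h0 ↦ ?_, fun h ↦ ?_⟩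
  · rw [h0, map_zero, norm_zero] at hKg
    exact hM0.ne hKg
  · rw [← ContinuousLinearMap.adjoint_inner_right, ← inner_smul_right, ← hSg]; rfl

/-- A family of compact operators with a common domain gives a compact operator into the product. -/
theorem IsCompactOperator.pi {ι : Type*} [Finite ι] {M : Type*} {N : ι → Type*} [Zero M]
    [TopologicalSpace M] [∀ i, TopologicalSpace (N i)] [∀ i, Zero (N i)] {f : ∀ i, M → N i}
    (hf : ∀ i, IsCompactOperator (f i)) : IsCompactOperator fun x i ↦ f i x := by
  choose K hK hKf using hf
  refine ⟨Set.univ.pi K, isCompact_univ_pi hK, ?_⟩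
  filter_upwards [Filter.eventually_all.2 hKf] with x hx i _ using hx i

variable {X H : Type*} [TopologicalSpace X] [CompactSpace X]
  [NormedAddCommGroup H] [InnerProductSpace 𝕜 H]

open BoundedContinuousFunction

/-- The operator from a Hilbert space to bounded continuous functions with a given kernel. -/
noncomputable def kernelOperator (k : C(X, H)) : H →L[𝕜] (X →ᵇ 𝕜) :=
  LinearMap.mkContinuous
    { toFun := fun f ↦ mkOfCompact ⟨fun x ↦ inner 𝕜 (k x) f, by fun_prop⟩
      map_add' := fun f g ↦ by ext x; simp [inner_add_right]
      map_smul' := fun c f ↦ by ext x; simp [inner_smul_right] }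
    ‖k‖ (fun f ↦ by
      refine (norm_le (by positivity)).2 fun x ↦ ?_
      exact (norm_inner_le_norm _ _).trans (by gcongr; exact k.norm_coe_le_norm x))

@[simp]
theorem kernelOperator_apply (k : C(X, H)) (f : H) (x : X) :
    kernelOperator (𝕜 := 𝕜) k f x = inner 𝕜 (k x) f := rfl

/-- Arzelà-Ascoli: by Cauchy-Schwarz, the images of the unit ball are bounded by `‖k‖` and share the
modulus of continuity of `k`. -/
theorem isCompactOperator_kernelOperator (k : C(X, H)) :
    IsCompactOperator (kernelOperator (𝕜 := 𝕜) k) := by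
  refine (isCompactOperator_iff_isCompact_closure_image_closedBall
    (kernelOperator (𝕜 := 𝕜) k).toLinearMap zero_lt_one).2 ?_
  refine arzela_ascoli (Metric.closedBall (0 : 𝕜) ‖k‖) (isCompact_closedBall _ _) _ ?_ ?_
  · rintro _ x ⟨f, hf, rfl⟩
    rw [mem_closedBall_zero_iff] at hf ⊢
    refine (norm_inner_le_norm (𝕜 := 𝕜) (k x) f).trans ?_
    exact (mul_le_of_le_one_right (norm_nonneg _) hf).trans (k.norm_coe_le_norm x)
  · intro x₀
    refine Metric.equicontinuousAt_of_continuity_modulus (fun x ↦ ‖k x₀ - k x‖) ?_ _ ?_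
    · have : Continuous fun x ↦ ‖k x₀ - k x‖ := by fun_prop
      simpa using this.tendsto x₀
    · refine .of_forall fun x ↦ ?_
      rintro ⟨_, f, hf, rfl⟩
      rw [mem_closedBall_zero_iff] at hf
      change dist (inner 𝕜 (k x₀) f) (inner 𝕜 (k x) f) ≤ _
      rw [dist_eq_norm, ← inner_sub_left]
      exact (norm_inner_le_norm _ _).trans (mul_le_of_le_one_right (norm_nonneg _) hf)

end CompactOperator

/-! ### Compactness of the Volterra operator -/

section Volterra

variable {𝕜 : Type*} [RCLike 𝕜] {ℓ : ℝ}

/-- The indicator functions of `[0, x]`, as a continuous curve in `L_2(0, ℓ)`. -/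
noncomputable def intervalIndicator (𝕜 : Type*) [RCLike 𝕜] (ℓ : ℝ) :
    C(Set.Icc 0 ℓ, Lp 𝕜 2 (volume.restrict (Set.Icc 0 ℓ))) where
  toFun x := indicatorConstLp 2 (measurableSet_Icc (a := (0 : ℝ)) (b := x))
    (measure_ne_top _ _) 1
  continuous_toFun := by
    refine continuous_iff_continuousAt.2 fun x₀ ↦ ?_
    refine tendsto_indicatorConstLp_set (by norm_num) ?_
    have hlim : Filter.Tendsto (fun x : Set.Icc 0 ℓ ↦ ENNReal.ofReal (dist x x₀)) (nhds x₀)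
        (nhds 0) := by
      have : Continuous fun x : Set.Icc 0 ℓ ↦ ENNReal.ofReal (dist x x₀) :=
        ENNReal.continuous_ofReal.comp (by fun_prop)
      simpa using this.tendsto x₀
    refine tendsto_of_tendsto_of_tendsto_of_le_of_le tendsto_const_nhds hlim
      (fun _ ↦ zero_le) fun x ↦ ?_
    have hsub : symmDiff (Set.Icc (0 : ℝ) x) (Set.Icc 0 x₀) ⊆ Set.uIcc (x : ℝ) x₀ := by
      rintro t (⟨h1, h2⟩ | ⟨h1, h2⟩)
      · rw [Set.mem_Icc, not_and, not_le] at h2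
        exact Set.mem_uIcc.2 (.inr ⟨(h2 h1.1).le, h1.2⟩)
      · rw [Set.mem_Icc, not_and, not_le] at h2
        exact Set.mem_uIcc.2 (.inl ⟨(h2 h1.1).le, h1.2⟩)
    refine (Measure.restrict_apply_le _ _).trans ((measure_mono hsub).trans ?_)
    rw [Real.volume_interval, Subtype.dist_eq, Real.dist_eq, abs_sub_comm]

/-- This exhibits the primitive as an operator with continuous kernel, so that Arzelà-Ascoli
applies. -/
theorem inner_intervalIndicator (x : Set.Icc 0 ℓ)
    (f : Lp 𝕜 2 (volume.restrict (Set.Icc 0 ℓ))) :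
    inner 𝕜 (intervalIndicator 𝕜 ℓ x) f = ∫ t in (0 : ℝ)..x, f t := by
  rw [intervalIntegral_eq_integral_Icc x.2.1]
  refine (L2.inner_indicatorConstLp_one measurableSet_Icc (measure_ne_top _ _) f).trans ?_
  rw [Measure.restrict_restrict measurableSet_Icc,
    Set.inter_eq_left.2 (Set.Icc_subset_Icc_right x.2.2)]

open BoundedContinuousFunction

theorem memLp_IccExtend (hℓ : 0 ≤ ℓ) (f : Set.Icc 0 ℓ →ᵇ 𝕜) :
    MemLp (Set.IccExtend hℓ f) 2 (volume.restrict (Set.Icc 0 ℓ)) :=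
  (f.continuous.Icc_extend' (h := hℓ)).continuousOn.memLp_restrict_Icc 2

/-- The embedding of the continuous functions on `[0, ℓ]` into `L_2(0, ℓ)`. -/
noncomputable def boundedContinuousToL2 (𝕜 : Type*) [RCLike 𝕜] (hℓ : 0 ≤ ℓ) :
    (Set.Icc 0 ℓ →ᵇ 𝕜) →L[𝕜] Lp 𝕜 2 (volume.restrict (Set.Icc 0 ℓ)) :=
  LinearMap.mkContinuous
    { toFun := fun f ↦ (memLp_IccExtend hℓ f).toLp
      map_add' := fun f g ↦ rfl
      map_smul' := fun c f ↦ rfl } _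
    (fun f ↦ by
      refine Lp.norm_le_of_ae_bound (norm_nonneg f) ?_
      filter_upwards [(memLp_IccExtend hℓ f).coeFn_toLp] with x hx
      change ‖(memLp_IccExtend hℓ f).toLp _ x‖ ≤ _
      rw [hx]
      exact f.norm_coe_le_norm _)

/-- The Volterra operator `f ↦ ∫₀ˣ f` on `L_2(0, ℓ)`. -/
noncomputable def volterra (𝕜 : Type*) [RCLike 𝕜] (hℓ : 0 ≤ ℓ) :
    Lp 𝕜 2 (volume.restrict (Set.Icc 0 ℓ)) →L[𝕜] Lp 𝕜 2 (volume.restrict (Set.Icc 0 ℓ)) :=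
  boundedContinuousToL2 𝕜 hℓ ∘L kernelOperator (intervalIndicator 𝕜 ℓ)

theorem isCompactOperator_volterra (hℓ : 0 ≤ ℓ) : IsCompactOperator (volterra 𝕜 hℓ) :=
  (isCompactOperator_kernelOperator (intervalIndicator 𝕜 ℓ)).clm_comp (boundedContinuousToL2 𝕜 hℓ)

theorem coeFn_volterra (hℓ : 0 ≤ ℓ) (f : Lp 𝕜 2 (volume.restrict (Set.Icc 0 ℓ))) :
    volterra 𝕜 hℓ f =ᵐ[volume.restrict (Set.Icc 0 ℓ)] fun x ↦ ∫ t in (0 : ℝ)..x, f t := by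
  have h := MemLp.coeFn_toLp
    (memLp_IccExtend hℓ (kernelOperator (𝕜 := 𝕜) (intervalIndicator 𝕜 ℓ) f))
  filter_upwards [h, ae_restrict_mem measurableSet_Icc] with x hx hx'
  refine hx.trans ?_
  rw [Set.IccExtend_of_mem _ _ hx', kernelOperator_apply, inner_intervalIndicator]

end Volterra

/-! ### The Sobolev space of a metric graph and Green's identity -/

namespace MetricGraph

variable {𝕜 : Type*} [RCLike 𝕜] {V E : Type*} [Fintype E]

/-- Every vertex contains one of the finitely many end points. Finiteness allows boundary terms to
be summed over vertices. -/
theorem finite_vertices (Γ : MetricGraph V E) : Finite V := by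
  refine Finite.of_surjective (Sum.elim Γ.start Γ.finish) fun v ↦ ?_
  obtain ⟨e, he | he⟩ := Γ.exists_edge v
  · exact ⟨.inl e, he⟩
  · exact ⟨.inr e, he⟩

/-- A function of the vertices without increments along the edges of a connected graph is
constant. -/
theorem Connected.eq_of_start_eq_finish {Γ : MetricGraph V E} (hΓ : Γ.Connected) {α : Type*}
    {a : V → α} (h : ∀ e, a (Γ.start e) = a (Γ.finish e)) (v w : V) : a v = a w := by
  obtain ⟨p⟩ := hΓ.preconnected v w
  induction p with
  | nil => rfl
  | cons hadj _ ih =>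
    refine Eq.trans ?_ ih
    rw [SimpleGraph.fromRel_adj] at hadj
    obtain ⟨-, ⟨e, rfl, rfl⟩ | ⟨e, rfl, rfl⟩⟩ := hadj
    · exact h e
    · exact (h e).symm

theorem Connected.nonempty_edge {Γ : MetricGraph V E} (hΓ : Γ.Connected) : Nonempty E := by
  obtain ⟨v⟩ := hΓ.nonempty
  exact ⟨(Γ.exists_edge v).choose⟩

theorem Connected.addEdge {Γ : MetricGraph V E} (hΓ : Γ.Connected) (V₁ V₂ : V) (ℓ : ℝ)
    (hℓ : 0 < ℓ) : (Γ.addEdge V₁ V₂ ℓ hℓ).Connected := by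
  refine SimpleGraph.Connected.mono ?_ hΓ
  intro v w h
  rw [SimpleGraph.fromRel_adj] at h ⊢
  refine ⟨h.1, h.2.imp ?_ ?_⟩ <;> exact fun ⟨e, he⟩ ↦ ⟨some e, he⟩

/-- The family `u` of functions on the edges belongs to the Sobolev space `W_2^1` of the graph: it
has weak derivative `u'`, and it is continuous at the vertices, with values `a`. -/
structure IsSobolev (Γ : MetricGraph V E) (u u' : E → ℝ → 𝕜) (a : V → 𝕜) : Prop where
  deriv : ∀ e, HasSobolevDeriv (Γ.length e) (u e) (u' e)
  start : ∀ e, u e 0 = a (Γ.start e)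
  finish : ∀ e, u e (Γ.length e) = a (Γ.finish e)

/-- The inner product of `L_2` of the graph. -/
noncomputable def innerL2 (Γ : MetricGraph V E) (f g : E → ℝ → 𝕜) : 𝕜 :=
  ∑ e, ∫ x in Set.Icc 0 (Γ.length e), inner 𝕜 (f e x) (g e x)

/-- The squared norm of `L_2` of the graph. -/
noncomputable def normSqL2 (Γ : MetricGraph V E) (f : E → ℝ → 𝕜) : ℝ :=
  ∑ e, ∫ x in Set.Icc 0 (Γ.length e), ‖f e x‖ ^ 2

section L2

variable (Γ : MetricGraph V E)

theorem innerL2_self (f : E → ℝ → 𝕜) : Γ.innerL2 f f = (Γ.normSqL2 f : 𝕜) := by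
  simp only [innerL2, normSqL2, RCLike.ofReal_sum, inner_self_eq_norm_sq_to_K]
  refine Finset.sum_congr rfl fun e _ ↦ ?_
  rw [← integral_ofReal]
  simp

theorem normSqL2_nonneg (f : E → ℝ → 𝕜) : 0 ≤ Γ.normSqL2 f :=
  Finset.sum_nonneg fun _ _ ↦ integral_nonneg fun _ ↦ by positivity

variable {Γ}

theorem innerL2_congr_right {f g h : E → ℝ → 𝕜}
    (H : ∀ e, g e =ᵐ[volume.restrict (Set.Icc 0 (Γ.length e))] h e) :
    Γ.innerL2 f g = Γ.innerL2 f h := by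
  refine Finset.sum_congr rfl fun e _ ↦ integral_congr_ae ?_
  filter_upwards [H e] with x hx
  rw [hx]

theorem innerL2_const_mul_right (f g : E → ℝ → 𝕜) (c : 𝕜) :
    Γ.innerL2 f (fun e x ↦ c * g e x) = c * Γ.innerL2 f g := by
  simp only [innerL2, Finset.mul_sum]
  refine Finset.sum_congr rfl fun e _ ↦ ?_
  rw [← integral_const_mul]
  exact integral_congr_ae (.of_forall fun x ↦ by simp only [RCLike.inner_apply]; ring)

theorem innerL2_conj (f g : E → ℝ → 𝕜) :
    (starRingEnd 𝕜) (Γ.innerL2 f g) = Γ.innerL2 g f := by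
  simp only [innerL2, map_sum]
  refine Finset.sum_congr rfl fun e _ ↦ ?_
  rw [← integral_conj]
  simp only [inner_conj_symm]

theorem integrable_inner {ℓ : ℝ} {f g : ℝ → 𝕜}
    (hf : MemLp f 2 (volume.restrict (Set.Icc 0 ℓ)))
    (hg : MemLp g 2 (volume.restrict (Set.Icc 0 ℓ))) :
    IntegrableOn (fun x ↦ inner 𝕜 (f x) (g x)) (Set.Icc 0 ℓ) := by
  simp only [RCLike.inner_apply]
  exact hg.integrable_mul hf.star

theorem innerL2_sub_right {f g h : E → ℝ → 𝕜}
    (hf : ∀ e, MemLp (f e) 2 (volume.restrict (Set.Icc 0 (Γ.length e))))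
    (hg : ∀ e, MemLp (g e) 2 (volume.restrict (Set.Icc 0 (Γ.length e))))
    (hh : ∀ e, MemLp (h e) 2 (volume.restrict (Set.Icc 0 (Γ.length e)))) :
    Γ.innerL2 f (fun e x ↦ g e x - h e x) = Γ.innerL2 f g - Γ.innerL2 f h := by
  simp only [innerL2, ← Finset.sum_sub_distrib]
  refine Finset.sum_congr rfl fun e _ ↦ ?_
  rw [← integral_sub (integrable_inner (hf e) (hg e)) (integrable_inner (hf e) (hh e))]
  simp only [inner_sub_right]

theorem innerL2_sub_left {f g h : E → ℝ → 𝕜}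
    (hf : ∀ e, MemLp (f e) 2 (volume.restrict (Set.Icc 0 (Γ.length e))))
    (hg : ∀ e, MemLp (g e) 2 (volume.restrict (Set.Icc 0 (Γ.length e))))
    (hh : ∀ e, MemLp (h e) 2 (volume.restrict (Set.Icc 0 (Γ.length e)))) :
    Γ.innerL2 (fun e x ↦ g e x - h e x) f = Γ.innerL2 g f - Γ.innerL2 h f := by
  rw [← innerL2_conj, innerL2_sub_right hf hg hh, map_sub, innerL2_conj, innerL2_conj]

theorem ae_eq_zero_of_integral_norm_sq_le {ℓ : ℝ} {f : ℝ → 𝕜}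
    (hf : MemLp f 2 (volume.restrict (Set.Icc 0 ℓ)))
    (h : ∫ x in Set.Icc 0 ℓ, ‖f x‖ ^ 2 ≤ 0) : f =ᵐ[volume.restrict (Set.Icc 0 ℓ)] 0 := by
  have h0 : ∫ x in Set.Icc 0 ℓ, ‖f x‖ ^ 2 = 0 :=
    le_antisymm h (integral_nonneg fun _ ↦ by positivity)
  rw [integral_eq_zero_iff_of_nonneg (fun _ ↦ by positivity)
    ((memLp_two_iff_integrable_sq_norm hf.1).1 hf)] at h0
  filter_upwards [h0] with x hx
  simpa using hx

theorem ae_eq_zero_of_normSqL2_le {f : E → ℝ → 𝕜}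
    (hf : ∀ e, MemLp (f e) 2 (volume.restrict (Set.Icc 0 (Γ.length e))))
    (h : Γ.normSqL2 f ≤ 0) (e : E) :
    f e =ᵐ[volume.restrict (Set.Icc 0 (Γ.length e))] 0 := by
  refine ae_eq_zero_of_integral_norm_sq_le (hf e) (le_trans ?_ h)
  exact Finset.single_le_sum (f := fun e ↦ ∫ x in Set.Icc 0 (Γ.length e), ‖f e x‖ ^ 2)
    (fun _ _ ↦ integral_nonneg fun _ ↦ by positivity) (Finset.mem_univ e)

end L2

namespace IsSobolev

variable {Γ : MetricGraph V E} {u u' w w' w'' : E → ℝ → 𝕜} {a : V → 𝕜}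

theorem memLp (hu : Γ.IsSobolev u u' a) (e : E) :
    MemLp (u e) 2 (volume.restrict (Set.Icc 0 (Γ.length e))) :=
  (hu.deriv e).memLp (Γ.length_pos e).le

theorem memLp_deriv (hu : Γ.IsSobolev u u' a) (e : E) :
    MemLp (u' e) 2 (volume.restrict (Set.Icc 0 (Γ.length e))) :=
  (hu.deriv e).1

theorem const (c : 𝕜) : Γ.IsSobolev (fun _ _ ↦ c) (fun _ _ ↦ 0) fun _ ↦ c :=
  ⟨fun _ ↦ HasSobolevDeriv.const c, fun _ ↦ rfl, fun _ ↦ rfl⟩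

theorem sub_const (hu : Γ.IsSobolev u u' a) (c : 𝕜) :
    Γ.IsSobolev (fun e x ↦ u e x - c) u' fun v ↦ a v - c :=
  ⟨fun e ↦ (hu.deriv e).sub_const c, fun e ↦ by simp only [hu.start],
    fun e ↦ by simp only [hu.finish]⟩

/-- Green's identity, with the boundary terms. -/
theorem innerL2_deriv (hu : Γ.IsSobolev u u' a)
    (hw : ∀ e, HasSobolevDeriv (Γ.length e) (w' e) (w'' e)) :
    Γ.innerL2 u w'' = ∑ e, (inner 𝕜 (a (Γ.finish e)) (w' e (Γ.length e)) -
      inner 𝕜 (a (Γ.start e)) (w' e 0)) - Γ.innerL2 u' w' := by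
  simp only [innerL2, ← Finset.sum_sub_distrib]
  refine Finset.sum_congr rfl fun e _ ↦ ?_
  rw [(hu.deriv e).integral_inner_deriv (Γ.length_pos e).le (hw e), hu.start, hu.finish]

open Classical in
/-- The boundary terms in Green's identity, sorted by vertices. -/
theorem _root_.MetricGraph.sum_inner_sub_inner [Fintype V] (Γ : MetricGraph V E) (a : V → 𝕜)
    (w' : E → ℝ → 𝕜) :
    ∑ e, (inner 𝕜 (a (Γ.finish e)) (w' e (Γ.length e)) - inner 𝕜 (a (Γ.start e)) (w' e 0)) =
      -∑ v, inner 𝕜 (a v) (∑ e with Γ.start e = v, w' e 0 -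
        ∑ e with Γ.finish e = v, w' e (Γ.length e)) := by
  have h : ∀ (p : E → V) (t : E → 𝕜), ∑ e, inner 𝕜 (a (p e)) (t e) =
      ∑ v, inner 𝕜 (a v) (∑ e with p e = v, t e) := fun p t ↦ by
    rw [← Finset.sum_fiberwise Finset.univ p]
    refine Finset.sum_congr rfl fun v _ ↦ ?_
    rw [inner_sum]
    exact Finset.sum_congr rfl fun e he ↦ by rw [(Finset.mem_filter.1 he).2]
  rw [Finset.sum_sub_distrib, h, h]
  simp only [inner_sub_right, Finset.sum_sub_distrib]
  ring

open Classical in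
/-- Green's identity for functions that satisfy Kirchhoff's condition. -/
theorem innerL2_deriv_of_kirchhoff (hu : Γ.IsSobolev u u' a)
    (hw : ∀ e, HasSobolevDeriv (Γ.length e) (w' e) (w'' e))
    (hk : ∀ v, ∑ e with Γ.start e = v, w' e 0
      - ∑ e with Γ.finish e = v, w' e (Γ.length e) = 0) :
    Γ.innerL2 u w'' = -Γ.innerL2 u' w' := by
  have := Γ.finite_vertices
  have := Fintype.ofFinite V
  rw [hu.innerL2_deriv hw, sum_inner_sub_inner]
  simp [hk]

/-- A function with vanishing derivative on a connected graph is constant. -/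
theorem eq_of_normSqL2_deriv_le (hΓ : Γ.Connected) (hu : Γ.IsSobolev u u' a)
    (h : Γ.normSqL2 u' ≤ 0) : ∃ c, ∀ e, ∀ x ∈ Set.Icc 0 (Γ.length e), u e x = c := by
  have hconst : ∀ e, ∀ x ∈ Set.Icc 0 (Γ.length e), u e x = a (Γ.start e) := fun e x hx ↦ by
    have h1 := ((HasSobolevDeriv.const (ℓ := Γ.length e) (a (Γ.start e))).congr
      (Γ.length_pos e).le (fun _ _ ↦ rfl) (ae_eq_zero_of_normSqL2_le hu.memLp_deriv h e)).2 x hx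
    rw [(hu.deriv e).2 x hx, hu.start]
    exact h1.symm
  obtain ⟨v⟩ := hΓ.nonempty
  refine ⟨a v, fun e x hx ↦ (hconst e x hx).trans (hΓ.eq_of_start_eq_finish (fun e ↦ ?_) _ _)⟩
  rw [← hu.finish, hconst e _ ⟨(Γ.length_pos e).le, le_rfl⟩]

end IsSobolev

/-! ### Eigenfunctions and the weak eigenvalue equation -/

section Eigenfunction

variable {Γ : MetricGraph V E} {u : Γ.EdgeFun 𝕜} {ν : ℝ}

theorem onEdge_of_mem (u : Γ.EdgeFun 𝕜) (e : E) {x : ℝ} (hx : x ∈ Set.Icc 0 (Γ.length e)) :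
    Γ.onEdge u e x = u e ⟨x, hx⟩ :=
  Set.IccExtend_of_mem _ _ hx

/-- An eigenfunction belongs to the Sobolev space, and satisfies the weak eigenvalue equation. -/
theorem IsEigenfunction.exists_isSobolev (hu : Γ.IsEigenfunction ν u) :
    ∃ (u' : E → ℝ → 𝕜) (a : V → 𝕜), Γ.IsSobolev (Γ.onEdge u) u' a ∧ (∀ v, Γ.HasValueAt u v (a v)) ∧
      ∀ (φ φ' : E → ℝ → 𝕜) (b : V → 𝕜), Γ.IsSobolev φ φ' b →
        (ν : 𝕜) * Γ.innerL2 φ (Γ.onEdge u) = Γ.innerL2 φ' u' := by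
  obtain ⟨-, u', u'', hd, heq⟩ := hu
  choose a ha using hd.continuous
  refine ⟨u', a, ⟨hd.deriv_one, fun e ↦ (ha _).1 e rfl, fun e ↦ (ha _).2 e rfl⟩, ha,
    fun φ φ' b hφ ↦ ?_⟩
  have h := hφ.innerL2_deriv_of_kirchhoff hd.deriv_two hd.kirchhoff
  have h2 : Γ.innerL2 φ u'' = Γ.innerL2 φ fun e x ↦ (-(ν : 𝕜)) * Γ.onEdge u e x := by
    refine innerL2_congr_right fun e ↦ ?_
    filter_upwards [heq e] with x hx
    rw [neg_mul, ← hx, neg_neg]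
  rw [h2, innerL2_const_mul_right] at h
  linear_combination -h

/-- Continuity on the closed edges upgrades vanishing almost everywhere to vanishing at every point.
-/
theorem IsSobolev.normSqL2_onEdge_pos {u' : E → ℝ → 𝕜} {a : V → 𝕜}
    (hu : Γ.IsSobolev (Γ.onEdge u) u' a) (hu0 : u ≠ 0) : 0 < Γ.normSqL2 (Γ.onEdge u) := by
  refine (Γ.normSqL2_nonneg _).lt_of_ne' fun h ↦ hu0 ?_
  have h0 := ae_eq_zero_of_normSqL2_le hu.memLp h.le
  funext e x
  have hc : ContinuousOn (Γ.onEdge u e) (Set.Icc 0 (Γ.length e)) :=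
    (hu.deriv e).continuousOn (Γ.length_pos e).le
  have := Measure.eqOn_Icc_of_ae_eq volume (Γ.length_pos e).ne (h0 e) hc continuousOn_const x.2
  rwa [onEdge_of_mem u e x.2] at this

/-- On a connected graph, the eigenfunctions with eigenvalues `≤ 0` are constant. -/
theorem IsEigenfunction.eq_const_of_nonpos (hΓ : Γ.Connected) (hu : Γ.IsEigenfunction ν u)
    (hν : ν ≤ 0) : ∃ c, u = fun _ _ ↦ c := by
  obtain ⟨u', a, hs, -, hw⟩ := hu.exists_isSobolev
  have h := hw _ _ _ hs
  rw [innerL2_self, innerL2_self] at h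
  have h : ν * Γ.normSqL2 (Γ.onEdge u) = Γ.normSqL2 u' := by exact_mod_cast h
  obtain ⟨c, hc⟩ := hs.eq_of_normSqL2_deriv_le hΓ
    (h ▸ mul_nonpos_of_nonpos_of_nonneg hν (Γ.normSqL2_nonneg _))
  refine ⟨c, funext fun e ↦ funext fun x ↦ ?_⟩
  rw [← hc e x x.2, onEdge_of_mem u e x.2]

theorem isEigenfunction_zero_one (hΓ : Γ.Connected) :
    Γ.IsEigenfunction 0 (fun _ _ ↦ 1 : Γ.EdgeFun 𝕜) := by
  obtain ⟨e₀⟩ := hΓ.nonempty_edge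
  refine ⟨fun h ↦ one_ne_zero (congrFun (congrFun h e₀) ⟨0, le_rfl, (Γ.length_pos e₀).le⟩),
    fun _ _ ↦ 0, fun _ _ ↦ 0, ⟨fun e ↦ HasSobolevDeriv.const 1, fun e ↦ HasSobolevDeriv.const 0,
      fun v ↦ ⟨1, fun _ _ ↦ rfl, fun _ _ ↦ rfl⟩, fun v ↦ by simp⟩, fun e ↦ by simp⟩

end Eigenfunction

end MetricGraph

namespace MetricGraph

variable {𝕜 : Type*} [RCLike 𝕜] {V E : Type*} [Fintype E] {Γ : MetricGraph V E}

/-! ### Regularity of weak eigenfunctions -/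

section Regularity

/-- The lemma of du Bois-Reymond: a square integrable function which is orthogonal to all functions
of mean zero is constant. -/
theorem ae_eq_const_of_integral_inner_eq_zero {ℓ : ℝ} (hℓ : 0 < ℓ) {q : ℝ → 𝕜}
    (hq : MemLp q 2 (volume.restrict (Set.Icc 0 ℓ)))
    (h : ∀ f : ℝ → 𝕜, MemLp f 2 (volume.restrict (Set.Icc 0 ℓ)) → ∫ x in Set.Icc 0 ℓ, f x = 0 →
      ∫ x in Set.Icc 0 ℓ, inner 𝕜 (f x) (q x) = 0) :
    ∃ c, q =ᵐ[volume.restrict (Set.Icc 0 ℓ)] fun _ ↦ c := by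
  set c : 𝕜 := (ℓ : 𝕜)⁻¹ * ∫ x in Set.Icc 0 ℓ, q x with hc
  have hℓ' : (ℓ : 𝕜) ≠ 0 := by simpa using hℓ.ne'
  have hcm : MemLp (fun _ : ℝ ↦ c) 2 (volume.restrict (Set.Icc 0 ℓ)) := memLp_const c
  have hqc : MemLp (fun x ↦ q x - c) 2 (volume.restrict (Set.Icc 0 ℓ)) := hq.sub hcm
  have hmean : ∫ x in Set.Icc 0 ℓ, (q x - c) = 0 := by
    rw [integral_sub (hq.integrable (by norm_num)) (hcm.integrable (by norm_num)),
      setIntegral_const, measureReal_def, Real.volume_Icc, sub_zero,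
      ENNReal.toReal_ofReal hℓ.le, RCLike.real_smul_eq_coe_mul, hc, mul_inv_cancel_left₀ hℓ',
      sub_self]
  -- With `c` the mean of `q`, the function `q - c` is an admissible test function; it is orthogonal
  -- to `q` by hypothesis and to `c` by its mean.
  have h1 : ∫ x in Set.Icc 0 ℓ, inner 𝕜 (q x - c) (q x - c) = 0 := by
    have h2 : ∀ x, inner 𝕜 (q x - c) (q x - c) = inner 𝕜 (q x - c) (q x) - inner 𝕜 (q x - c) c :=
      fun x ↦ inner_sub_right _ _ _
    simp only [h2]
    rw [integral_sub (integrable_inner hqc hq) (integrable_inner hqc hcm), h _ hqc hmean, zero_sub,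
      neg_eq_zero]
    simp only [RCLike.inner_apply]
    rw [integral_const_mul, integral_conj, hmean, map_zero, mul_zero]
  refine ⟨c, ?_⟩
  have h2 : ((∫ x in Set.Icc 0 ℓ, ‖q x - c‖ ^ 2 : ℝ) : 𝕜) = 0 := by
    rw [← integral_ofReal, ← h1]
    simp only [inner_self_eq_norm_sq_to_K, RCLike.ofReal_pow]
  have h3 := ae_eq_zero_of_integral_norm_sq_le hqc (RCLike.ofReal_eq_zero.1 h2).le
  filter_upwards [h3] with x hx using sub_eq_zero.1 hx

variable {u u' : E → ℝ → 𝕜} {a : V → 𝕜}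

/-- The functions in the Sobolev space that are supported on one edge. -/
theorem IsSobolev.single [DecidableEq E] (e₀ : E) {f : ℝ → 𝕜}
    (hf : MemLp f 2 (volume.restrict (Set.Icc 0 (Γ.length e₀))))
    (hmean : ∫ x in Set.Icc 0 (Γ.length e₀), f x = 0) :
    Γ.IsSobolev (Pi.single e₀ fun x ↦ ∫ t in (0 : ℝ)..x, f t) (Pi.single e₀ f) 0 := by
  refine ⟨fun e ↦ ?_, fun e ↦ ?_, fun e ↦ ?_⟩ <;> obtain rfl | he := eq_or_ne e e₀
  · simpa using HasSobolevDeriv.primitive hf 0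
  · rw [Pi.single_eq_of_ne he, Pi.single_eq_of_ne he]
    exact HasSobolevDeriv.const 0
  · simp
  · simp [he]
  · simpa [intervalIntegral_eq_integral_Icc (Γ.length_pos e).le] using hmean
  · simp [he]

theorem innerL2_single_left [DecidableEq E] (e₀ : E) (f : ℝ → 𝕜) (g : E → ℝ → 𝕜) :
    Γ.innerL2 (Pi.single e₀ f) g = ∫ x in Set.Icc 0 (Γ.length e₀), inner 𝕜 (f x) (g e₀ x) := by
  rw [innerL2, Finset.sum_eq_single e₀]
  · simp
  · intro e _ he
    simp [he]
  · simp

/-- The vertex values of a function in the Sobolev space can be prescribed. -/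
theorem exists_isSobolev_of_values (Γ : MetricGraph V E) (a : V → 𝕜) :
    ∃ φ φ' : E → ℝ → 𝕜, Γ.IsSobolev φ φ' a := by
  refine ⟨fun e x ↦ a (Γ.start e) + ∫ t in (0 : ℝ)..x,
    (Γ.length e : 𝕜)⁻¹ * (a (Γ.finish e) - a (Γ.start e)),
    fun e x ↦ (Γ.length e : 𝕜)⁻¹ * (a (Γ.finish e) - a (Γ.start e)),
    fun e ↦ HasSobolevDeriv.primitive (memLp_const _) _, fun e ↦ by simp, fun e ↦ ?_⟩
  have : (Γ.length e : 𝕜) ≠ 0 := by simpa using (Γ.length_pos e).ne'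
  simp only [intervalIntegral.integral_const, sub_zero, RCLike.real_smul_eq_coe_mul]
  field_simp
  ring

open Classical in
/-- Regularity of weak eigenfunctions. -/
theorem IsSobolev.exists_deriv_two (hu : Γ.IsSobolev u u' a) {M : ℝ} (hM : M ≠ 0)
    (hw : ∀ (φ φ' : E → ℝ → 𝕜) (b : V → 𝕜), Γ.IsSobolev φ φ' b →
      Γ.innerL2 φ u = (M : 𝕜) * Γ.innerL2 φ' u') :
    ∃ w' w'' : E → ℝ → 𝕜, (∀ e, w' e =ᵐ[volume.restrict (Set.Icc 0 (Γ.length e))] u' e) ∧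
      (∀ e, HasSobolevDeriv (Γ.length e) (w' e) (w'' e)) ∧
      (∀ e x, -w'' e x = ((M⁻¹ : ℝ) : 𝕜) * u e x) ∧
      ∀ v, ∑ e with Γ.start e = v, w' e 0 - ∑ e with Γ.finish e = v, w' e (Γ.length e) = 0 := by
  have hM' : (M : 𝕜) ≠ 0 := by simpa using hM
  have hp : ∀ e, HasSobolevDeriv (Γ.length e) (fun x ↦ ∫ t in (0 : ℝ)..x, u e t) (u e) := fun e ↦ by
    simpa using HasSobolevDeriv.primitive (hu.memLp e) 0
  -- The integrated form of `M u'' + u = 0`. For `f` of mean zero on one edge, the weak equation and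
  -- an integration by parts show that this expression is orthogonal to `f`.
  have hc : ∀ e, ∃ c, (fun x ↦ (M : 𝕜) * u' e x + ∫ t in (0 : ℝ)..x, u e t)
      =ᵐ[volume.restrict (Set.Icc 0 (Γ.length e))] fun _ ↦ c := fun e ↦ by
    have hℓ := (Γ.length_pos e).le
    have hm1 : MemLp (fun x ↦ (M : 𝕜) * u' e x) 2 (volume.restrict (Set.Icc 0 (Γ.length e))) :=
      (hu.memLp_deriv e).const_mul _
    refine ae_eq_const_of_integral_inner_eq_zero (Γ.length_pos e)
      (hm1.add ((hp e).memLp hℓ)) fun f hf hmean ↦ ?_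
    have h1 := hw _ _ _ (IsSobolev.single e hf hmean)
    rw [innerL2_single_left, innerL2_single_left] at h1
    have hF := HasSobolevDeriv.primitive hf 0
    rw [show (fun x ↦ (0 : 𝕜) + ∫ t in (0 : ℝ)..x, f t) = fun x ↦ ∫ t in (0 : ℝ)..x, f t by simp]
      at hF
    have h2 := hF.integral_inner_deriv hℓ (hp e)
    rw [h1, intervalIntegral_eq_integral_Icc hℓ, hmean, inner_zero_left, zero_sub] at h2
    simp only [intervalIntegral.integral_same, inner_zero_left, neg_zero, zero_sub] at h2
    simp only [inner_add_right]
    rw [integral_add (integrable_inner hf hm1) (integrable_inner hf ((hp e).memLp hℓ))]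
    rw [← integral_const_mul] at h2
    rw [eq_neg_iff_add_eq_zero] at h2
    rw [← h2]
    congr 1
    refine integral_congr_ae (.of_forall fun x ↦ ?_)
    simp only [RCLike.inner_apply]
    ring
  choose c hc using hc
  -- Solving `M u' + ∫ u = c` for `u'` yields its absolutely continuous representative.
  set w' : E → ℝ → 𝕜 := fun e x ↦ (-(M : 𝕜)⁻¹) * ((∫ t in (0 : ℝ)..x, u e t) - c e) with hw'
  set w'' : E → ℝ → 𝕜 := fun e x ↦ (-(M : 𝕜)⁻¹) * u e x with hw''
  have hww : ∀ e, HasSobolevDeriv (Γ.length e) (w' e) (w'' e) := fun e ↦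
    ((hp e).sub_const (c e)).const_mul _
  have hae : ∀ e, w' e =ᵐ[volume.restrict (Set.Icc 0 (Γ.length e))] u' e := fun e ↦ by
    filter_upwards [hc e] with x hx
    simp only [hw', ← hx]
    field_simp
    ring
  refine ⟨w', w'', hae, hww, fun e x ↦ ?_, fun v ↦ ?_⟩
  · simp only [hw'', RCLike.ofReal_inv]
    ring
  · have := Γ.finite_vertices
    have := Fintype.ofFinite V
    -- A test function with value one at `v` and zero at all other vertices isolates the boundary
    -- term at `v` in Green's identity.
    obtain ⟨φ, φ', hφ⟩ := Γ.exists_isSobolev_of_values (Pi.single v (1 : 𝕜))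
    have h1 := hφ.innerL2_deriv hww
    rw [sum_inner_sub_inner, Finset.sum_eq_single v, Pi.single_eq_same, hw'',
      innerL2_const_mul_right, hw φ φ' _ hφ, innerL2_congr_right hae] at h1
    · rw [RCLike.inner_apply, map_one, mul_one, neg_mul, inv_mul_cancel_left₀ hM'] at h1
      linear_combination h1
    · intro v' _ hv'
      simp [hv']
    · simp

end Regularity

/-! ### Gradients and the compact primitive operator -/

section Operator

/-- `L_2` of the graph. -/
abbrev L2 (𝕜 : Type*) [RCLike 𝕜] (Γ : MetricGraph V E) : Type _ :=
  PiLp 2 fun e ↦ Lp 𝕜 2 (volume.restrict (Set.Icc 0 (Γ.length e)))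

/-- The element of `L_2` of the graph which is given by square integrable functions on the
edges. -/
noncomputable def toL2 (Γ : MetricGraph V E) (f : E → ℝ → 𝕜)
    (hf : ∀ e, MemLp (f e) 2 (volume.restrict (Set.Icc 0 (Γ.length e)))) : Γ.L2 𝕜 :=
  WithLp.toLp 2 fun e ↦ (hf e).toLp

theorem inner_toL2 {f g : E → ℝ → 𝕜}
    (hf : ∀ e, MemLp (f e) 2 (volume.restrict (Set.Icc 0 (Γ.length e))))
    (hg : ∀ e, MemLp (g e) 2 (volume.restrict (Set.Icc 0 (Γ.length e)))) :
    inner 𝕜 (Γ.toL2 f hf) (Γ.toL2 g hg) = Γ.innerL2 f g := by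
  rw [PiLp.inner_apply]
  refine Finset.sum_congr rfl fun e _ ↦ ?_
  rw [L2.inner_def]
  refine integral_congr_ae ?_
  filter_upwards [(hf e).coeFn_toLp, (hg e).coeFn_toLp] with x hx hx'
  simp only [toL2, hx, hx']

theorem norm_sq_toL2 {f : E → ℝ → 𝕜}
    (hf : ∀ e, MemLp (f e) 2 (volume.restrict (Set.Icc 0 (Γ.length e)))) :
    ‖Γ.toL2 f hf‖ ^ 2 = Γ.normSqL2 f := by
  have h := inner_toL2 hf hf
  rw [inner_self_eq_norm_sq_to_K, innerL2_self] at h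
  exact_mod_cast h

theorem toL2_coeFn (g : Γ.L2 𝕜) : Γ.toL2 (fun e ↦ g e) (fun e ↦ Lp.memLp (g e)) = g := by
  refine PiLp.ext fun e ↦ ?_
  exact Lp.toLp_coeFn (g e) (Lp.memLp (g e))

theorem toL2_congr {f g : E → ℝ → 𝕜}
    (hf : ∀ e, MemLp (f e) 2 (volume.restrict (Set.Icc 0 (Γ.length e))))
    (hg : ∀ e, MemLp (g e) 2 (volume.restrict (Set.Icc 0 (Γ.length e))))
    (h : ∀ e, f e =ᵐ[volume.restrict (Set.Icc 0 (Γ.length e))] g e) :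
    Γ.toL2 f hf = Γ.toL2 g hg :=
  PiLp.ext fun e ↦ (MemLp.toLp_eq_toLp_iff (hf e) (hg e)).2 (h e)

/-- The increments of a function of the vertices along the edges. -/
def increments (𝕜 : Type*) [RCLike 𝕜] (Γ : MetricGraph V E) : (V → 𝕜) →ₗ[𝕜] (E → 𝕜) where
  toFun a e := a (Γ.finish e) - a (Γ.start e)
  map_add' a b := by ext e; simp; ring
  map_smul' c a := by ext e; simp; ring

/-- A right inverse of `f` onto its range, extended linearly to all of `B`. It serves to choose
potentials linearly in the increments. -/
theorem _root_.LinearMap.exists_comp_comp_eq_self {K A B : Type*} [DivisionRing K]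
    [AddCommGroup A] [Module K A] [AddCommGroup B] [Module K B] (f : A →ₗ[K] B) :
    ∃ s : B →ₗ[K] A, ∀ a, f (s (f a)) = f a := by
  obtain ⟨t, ht⟩ := f.rangeRestrict.exists_rightInverse_of_surjective
    (LinearMap.range_rangeRestrict f)
  obtain ⟨s, hs⟩ := t.exists_extend
  refine ⟨s, fun a ↦ ?_⟩
  have h1 : s (f a) = t (f.rangeRestrict a) := congrArg (· (f.rangeRestrict a)) hs
  have h2 : f.rangeRestrict (t (f.rangeRestrict a)) = f.rangeRestrict a :=
    congrArg (· (f.rangeRestrict a)) ht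
  rw [h1]
  exact congrArg Subtype.val h2

/-- A potential of the increments, if there is one. -/
noncomputable def potential (𝕜 : Type*) [RCLike 𝕜] (Γ : MetricGraph V E) :
    (E → 𝕜) →ₗ[𝕜] (V → 𝕜) :=
  (Γ.increments 𝕜).exists_comp_comp_eq_self.choose

theorem increments_potential {d : E → 𝕜} (hd : d ∈ LinearMap.range (Γ.increments 𝕜)) :
    Γ.increments 𝕜 (Γ.potential 𝕜 d) = d := by
  obtain ⟨a, rfl⟩ := hd
  exact (Γ.increments 𝕜).exists_comp_comp_eq_self.choose_spec a

/-- The integrals over the edges. -/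
noncomputable def edgeIntegrals (𝕜 : Type*) [RCLike 𝕜] (Γ : MetricGraph V E) :
    Γ.L2 𝕜 →L[𝕜] (E → 𝕜) :=
  ContinuousLinearMap.pi fun e ↦
    innerSL 𝕜 (intervalIndicator 𝕜 (Γ.length e) ⟨Γ.length e, (Γ.length_pos e).le, le_rfl⟩) ∘L
      PiLp.proj 2 (fun e ↦ Lp 𝕜 2 (volume.restrict (Set.Icc 0 (Γ.length e)))) e

theorem edgeIntegrals_apply (g : Γ.L2 𝕜) (e : E) :
    Γ.edgeIntegrals 𝕜 g e = ∫ t in (0 : ℝ)..Γ.length e, g e t :=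
  inner_intervalIndicator _ (g e)

/-- The gradients: the functions whose edge integrals are the increments of a function of the
vertices. -/
noncomputable def gradients (𝕜 : Type*) [RCLike 𝕜] (Γ : MetricGraph V E) : Submodule 𝕜 (Γ.L2 𝕜) :=
  (LinearMap.range (Γ.increments 𝕜)).comap (Γ.edgeIntegrals 𝕜).toLinearMap

theorem isClosed_gradients (𝕜 : Type*) [RCLike 𝕜] (Γ : MetricGraph V E) :
    IsClosed (Γ.gradients 𝕜 : Set (Γ.L2 𝕜)) :=
  (Submodule.closed_of_finiteDimensional (LinearMap.range (Γ.increments 𝕜))).preimage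
    (Γ.edgeIntegrals 𝕜).continuous

instance (𝕜 : Type*) [RCLike 𝕜] (Γ : MetricGraph V E) : CompleteSpace (Γ.gradients 𝕜) :=
  (isClosed_gradients 𝕜 Γ).completeSpace_coe

/-- A primitive of `g` on every edge, which is continuous on the graph if there is such a
primitive. -/
noncomputable def primitive (Γ : MetricGraph V E) (g : Γ.L2 𝕜) (e : E) (x : ℝ) : 𝕜 :=
  Γ.potential 𝕜 (Γ.edgeIntegrals 𝕜 g) (Γ.start e) + ∫ t in (0 : ℝ)..x, g e t

theorem hasSobolevDeriv_primitive (g : Γ.L2 𝕜) (e : E) :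
    HasSobolevDeriv (Γ.length e) (Γ.primitive g e) (g e) :=
  HasSobolevDeriv.primitive (Lp.memLp (g e)) _

theorem isSobolev_primitive {g : Γ.L2 𝕜} (hg : g ∈ Γ.gradients 𝕜) :
    Γ.IsSobolev (Γ.primitive g) (fun e ↦ g e) (Γ.potential 𝕜 (Γ.edgeIntegrals 𝕜 g)) := by
  refine ⟨hasSobolevDeriv_primitive g, fun e ↦ by simp [primitive], fun e ↦ ?_⟩
  have h := congrFun (increments_potential hg) e
  change Γ.potential 𝕜 (Γ.edgeIntegrals 𝕜 g) (Γ.finish e) -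
    Γ.potential 𝕜 (Γ.edgeIntegrals 𝕜 g) (Γ.start e) = Γ.edgeIntegrals 𝕜 g e at h
  rw [edgeIntegrals_apply] at h
  rw [primitive, ← h]
  ring

/-- The piecewise constant functions. -/
noncomputable def edgeConstants (𝕜 : Type*) [RCLike 𝕜] (Γ : MetricGraph V E) :
    (E → 𝕜) →ₗ[𝕜] Γ.L2 𝕜 where
  toFun c := Γ.toL2 (fun e _ ↦ c e) fun _ ↦ memLp_const _
  map_add' _ _ := rfl
  map_smul' _ _ := rfl

/-- The operator which maps `g` to its primitive. -/
noncomputable def primitiveOperator (𝕜 : Type*) [RCLike 𝕜] (Γ : MetricGraph V E) :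
    Γ.L2 𝕜 →L[𝕜] Γ.L2 𝕜 :=
  LinearMap.toContinuousLinearMap
      (Γ.edgeConstants 𝕜 ∘ₗ LinearMap.funLeft 𝕜 𝕜 Γ.start ∘ₗ Γ.potential 𝕜) ∘L Γ.edgeIntegrals 𝕜 +
    (PiLp.continuousLinearEquiv 2 𝕜 _).symm.toContinuousLinearMap ∘L
      ContinuousLinearMap.pi fun e ↦ volterra 𝕜 (Γ.length_pos e).le ∘L
        PiLp.proj 2 (fun e ↦ Lp 𝕜 2 (volume.restrict (Set.Icc 0 (Γ.length e)))) e

/-- The initial values on the edges depend on `g` only through finitely many integrals, which gives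
a finite-rank term; the rest is a Volterra operator on each edge. -/
theorem isCompactOperator_primitiveOperator (𝕜 : Type*) [RCLike 𝕜] (Γ : MetricGraph V E) :
    IsCompactOperator (Γ.primitiveOperator 𝕜) := by
  refine IsCompactOperator.add ?_ ?_
  · exact (isCompactOperator_of_locallyCompactSpace_dom (Γ.edgeIntegrals 𝕜)).clm_comp
      (LinearMap.toContinuousLinearMap
        (Γ.edgeConstants 𝕜 ∘ₗ LinearMap.funLeft 𝕜 𝕜 Γ.start ∘ₗ Γ.potential 𝕜))
  · refine IsCompactOperator.clm_comp ?_
      ((PiLp.continuousLinearEquiv 2 𝕜 fun e ↦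
        Lp 𝕜 2 (volume.restrict (Set.Icc 0 (Γ.length e)))).symm.toContinuousLinearMap)
    exact IsCompactOperator.pi fun e ↦ 
      (isCompactOperator_volterra (𝕜 := 𝕜) (Γ.length_pos e).le).comp_clm
        (PiLp.proj 2 (fun e ↦ Lp 𝕜 2 (volume.restrict (Set.Icc 0 (Γ.length e)))) e)

theorem primitiveOperator_apply (g : Γ.L2 𝕜) :
    Γ.primitiveOperator 𝕜 g = Γ.toL2 (Γ.primitive g)
      fun e ↦ (hasSobolevDeriv_primitive g e).memLp (Γ.length_pos e).le := by
  refine PiLp.ext fun e ↦ Lp.ext ?_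
  have h1 := (memLp_const (μ := volume.restrict (Set.Icc 0 (Γ.length e))) (p := 2)
    (Γ.potential 𝕜 (Γ.edgeIntegrals 𝕜 g) (Γ.start e))).coeFn_toLp
  have h2 := ((hasSobolevDeriv_primitive g e).memLp (Γ.length_pos e).le).coeFn_toLp
  have h3 := coeFn_volterra (Γ.length_pos e).le (g e)
  change ⇑((memLp_const (Γ.potential 𝕜 (Γ.edgeIntegrals 𝕜 g) (Γ.start e))).toLp +
    volterra 𝕜 (Γ.length_pos e).le (g e) : Lp 𝕜 2 (volume.restrict (Set.Icc 0 (Γ.length e))))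
      =ᵐ[_] _
  refine (Lp.coeFn_add _ _).trans ?_
  filter_upwards [h1, h2, h3] with x hx1 hx2 hx3
  rw [Pi.add_apply, hx1, hx3]
  exact hx2.symm

end Operator

end MetricGraph

namespace MetricGraph

variable {𝕜 : Type*} [RCLike 𝕜] {V E : Type*} [Fintype E] {Γ : MetricGraph V E}

/-! ### Functions of mean zero -/

section MeanZero

theorem innerL2_const_right (f : E → ℝ → 𝕜) (c : 𝕜) :
    Γ.innerL2 f (fun _ _ ↦ c) = c * Γ.innerL2 f fun _ _ ↦ 1 := by
  simpa using innerL2_const_mul_right (Γ := Γ) f (fun _ _ ↦ (1 : 𝕜)) c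

theorem innerL2_const_left_eq_zero {w : E → ℝ → 𝕜} (hw : Γ.innerL2 (fun _ _ ↦ 1) w = 0) (c : 𝕜) :
    Γ.innerL2 (fun _ _ ↦ c) w = 0 := by
  rw [← innerL2_conj, innerL2_const_right, map_mul, innerL2_conj, hw, mul_zero]

theorem Connected.innerL2_one_one_ne_zero (hΓ : Γ.Connected) :
    Γ.innerL2 (fun _ _ ↦ 1) (fun _ _ ↦ (1 : 𝕜)) ≠ 0 := by
  obtain ⟨e₀⟩ := hΓ.nonempty_edge
  rw [innerL2_self, Ne, RCLike.ofReal_eq_zero]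
  refine ne_of_gt (Finset.sum_pos (fun e _ ↦ ?_) ⟨e₀, Finset.mem_univ _⟩)
  simpa using Γ.length_pos e

theorem Connected.exists_innerL2_one_sub_const_eq_zero (hΓ : Γ.Connected) {u : E → ℝ → 𝕜}
    (hu : ∀ e, MemLp (u e) 2 (volume.restrict (Set.Icc 0 (Γ.length e)))) :
    ∃ c, Γ.innerL2 (fun _ _ ↦ 1) (fun e x ↦ u e x - c) = 0 := by
  refine ⟨Γ.innerL2 (fun _ _ ↦ 1) u / Γ.innerL2 (fun _ _ ↦ 1) (fun _ _ ↦ (1 : 𝕜)), ?_⟩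
  rw [innerL2_sub_right (fun _ ↦ memLp_const _) hu (fun _ ↦ memLp_const _), innerL2_const_right,
    div_mul_cancel₀ _ hΓ.innerL2_one_one_ne_zero, sub_self]

/-- Among the functions that differ by constants, the one of mean zero has the least norm. -/
theorem normSqL2_le_normSqL2_sub_const {u : E → ℝ → 𝕜}
    (hu : ∀ e, MemLp (u e) 2 (volume.restrict (Set.Icc 0 (Γ.length e))))
    (hmean : Γ.innerL2 (fun _ _ ↦ 1) u = 0) (c : 𝕜) :
    Γ.normSqL2 u ≤ Γ.normSqL2 fun e x ↦ u e x - c := by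
  have hc : ∀ e, MemLp (fun _ : ℝ ↦ c) 2 (volume.restrict (Set.Icc 0 (Γ.length e))) :=
    fun _ ↦ memLp_const _
  have huc : ∀ e, MemLp (fun x ↦ u e x - c) 2 (volume.restrict (Set.Icc 0 (Γ.length e))) :=
    fun e ↦ (hu e).sub (hc e)
  have h := Γ.innerL2_self fun e x ↦ u e x - c
  have h0 := innerL2_const_left_eq_zero hmean c
  have h0' : Γ.innerL2 u (fun _ _ ↦ c) = 0 := by rw [← innerL2_conj, h0, map_zero]
  rw [innerL2_sub_right huc hu hc, innerL2_sub_left hu hu hc,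
    innerL2_sub_left hc hu hc, h0, h0', innerL2_self, innerL2_self, sub_zero, zero_sub,
    sub_neg_eq_add] at h
  have h : Γ.normSqL2 u + Γ.normSqL2 (fun _ _ ↦ c) = Γ.normSqL2 fun e x ↦ u e x - c := by
    exact_mod_cast h
  have := Γ.normSqL2_nonneg fun _ _ ↦ c
  linarith

end MeanZero

/-! ### Existence of a minimizer of the Rayleigh quotient -/

section Existence

/-- The constant function `1` in `L_2` of the graph. -/
noncomputable def oneL2 (𝕜 : Type*) [RCLike 𝕜] (Γ : MetricGraph V E) : Γ.L2 𝕜 :=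
  Γ.toL2 (fun _ _ ↦ 1) fun _ ↦ memLp_const _

/-- The operator which maps (the projection to the gradients of) `g` to its primitive of mean
zero. -/
noncomputable def meanZeroPrimitive (𝕜 : Type*) [RCLike 𝕜] (Γ : MetricGraph V E) :
    Γ.L2 𝕜 →L[𝕜] Γ.L2 𝕜 :=
  (𝕜 ∙ Γ.oneL2 𝕜)ᗮ.starProjection ∘L Γ.primitiveOperator 𝕜 ∘L (Γ.gradients 𝕜).starProjection

theorem isCompactOperator_meanZeroPrimitive (𝕜 : Type*) [RCLike 𝕜] (Γ : MetricGraph V E) :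
    IsCompactOperator (Γ.meanZeroPrimitive 𝕜) :=
  ((isCompactOperator_primitiveOperator 𝕜 Γ).comp_clm (Γ.gradients 𝕜).starProjection).clm_comp
    ((𝕜 ∙ Γ.oneL2 𝕜)ᗮ.starProjection)

theorem meanZeroPrimitive_of_mem {g : Γ.L2 𝕜} (hg : g ∈ Γ.gradients 𝕜) :
    Γ.meanZeroPrimitive 𝕜 g =
      (𝕜 ∙ Γ.oneL2 𝕜)ᗮ.starProjection (Γ.primitiveOperator 𝕜 g) := by
  simp [meanZeroPrimitive, Submodule.starProjection_eq_self_iff.2 hg]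

theorem inner_oneL2_meanZeroPrimitive (g : Γ.L2 𝕜) :
    inner 𝕜 (Γ.oneL2 𝕜) (Γ.meanZeroPrimitive 𝕜 g) = 0 :=
  (Submodule.mem_orthogonal_singleton_iff_inner_right).1
    (Submodule.starProjection_apply_mem (𝕜 ∙ Γ.oneL2 𝕜)ᗮ _)

theorem starProjection_oneL2 :
    (𝕜 ∙ Γ.oneL2 𝕜)ᗮ.starProjection (Γ.oneL2 𝕜) = 0 :=
  Submodule.starProjection_orthogonalComplement_singleton_eq_zero _

theorem IsSobolev.toL2_mem_gradients {u u' : E → ℝ → 𝕜} {a : V → 𝕜} (hu : Γ.IsSobolev u u' a) :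
    Γ.toL2 u' hu.memLp_deriv ∈ Γ.gradients 𝕜 := by
  refine ⟨a, funext fun e ↦ ?_⟩
  have hℓ := (Γ.length_pos e).le
  refine Eq.trans ?_ (edgeIntegrals_apply _ e).symm
  have h := (hu.deriv e).2 _ ⟨hℓ, le_rfl⟩
  rw [hu.start, hu.finish] at h
  change a (Γ.finish e) - a (Γ.start e) = _
  rw [h, add_sub_cancel_left, intervalIntegral_eq_integral_Icc hℓ,
    intervalIntegral_eq_integral_Icc hℓ]
  exact integral_congr_ae (hu.memLp_deriv e).coeFn_toLp.symm

theorem toL2_sub_const {u : E → ℝ → 𝕜}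
    (hu : ∀ e, MemLp (u e) 2 (volume.restrict (Set.Icc 0 (Γ.length e)))) (c : 𝕜) :
    Γ.toL2 (fun e x ↦ u e x - c) (fun e ↦ (hu e).sub (memLp_const c)) =
      Γ.toL2 u hu - c • Γ.oneL2 𝕜 := by
  refine PiLp.ext fun e ↦ ?_
  change ((hu e).sub (memLp_const c)).toLp = (hu e).toLp - c • (memLp_const (1 : 𝕜)).toLp
  rw [← MemLp.toLp_const_smul, ← MemLp.toLp_sub]
  exact (MemLp.toLp_eq_toLp_iff _ _).2 (.of_forall fun x ↦ by simp)

/-- Two Sobolev primitives of `u'` differ on each edge by a constant, and by connectedness it is the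
same on all edges. The projection removes this constant and fixes `u`, which has mean zero. -/
theorem IsSobolev.meanZeroPrimitive_deriv (hΓ : Γ.Connected) {u u' : E → ℝ → 𝕜} {a : V → 𝕜}
    (hu : Γ.IsSobolev u u' a) (hmean : Γ.innerL2 (fun _ _ ↦ 1) u = 0) :
    Γ.meanZeroPrimitive 𝕜 (Γ.toL2 u' hu.memLp_deriv) = Γ.toL2 u hu.memLp := by
  set g := Γ.toL2 u' hu.memLp_deriv with hg
  have hgm : g ∈ Γ.gradients 𝕜 := hu.toL2_mem_gradients
  have hp := isSobolev_primitive hgm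
  set s := Γ.potential 𝕜 (Γ.edgeIntegrals 𝕜 g)
  have hdiff : ∀ e, ∀ x ∈ Set.Icc 0 (Γ.length e),
      u e x - Γ.primitive g e x = a (Γ.start e) - s (Γ.start e) := fun e x hx ↦ by
    have h1 := ((hp.deriv e).congr (Γ.length_pos e).le (fun _ _ ↦ rfl)
      (hu.memLp_deriv e).coeFn_toLp.symm).2 x hx
    rw [(hu.deriv e).2 x hx, h1, hu.start, hp.start]
    ring
  obtain ⟨v⟩ := hΓ.nonempty
  have hconst : ∀ w, a w - s w = a v - s v := fun w ↦
    hΓ.eq_of_start_eq_finish (a := fun w ↦ a w - s w) (fun e ↦ by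
      rw [← hdiff e _ ⟨(Γ.length_pos e).le, le_rfl⟩, hu.finish, hp.finish]) w v
  have hprim : Γ.primitiveOperator 𝕜 g = Γ.toL2 u hu.memLp - (a v - s v) • Γ.oneL2 𝕜 := by
    rw [primitiveOperator_apply, ← toL2_sub_const]
    refine toL2_congr _ _ fun e ↦ ?_
    filter_upwards [ae_restrict_mem measurableSet_Icc] with x hx
    rw [← hconst (Γ.start e), ← hdiff e x hx, sub_sub_cancel]
  rw [meanZeroPrimitive_of_mem hgm, hprim, map_sub, map_smul, starProjection_oneL2, smul_zero,
    sub_zero]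
  refine Submodule.starProjection_eq_self_iff.2
    ((Submodule.mem_orthogonal_singleton_iff_inner_right).2 ?_)
  rw [oneL2, inner_toL2, hmean]

/-- On a connected graph the quotient of the energy and the squared norm has a minimum on the
nonzero functions of mean zero; it is attained by an eigenfunction. -/
theorem exists_isEigenfunction_minimizer (hΓ : Γ.Connected)
    (hex : ∃ (u u' : E → ℝ → 𝕜) (a : V → 𝕜), Γ.IsSobolev u u' a ∧
      Γ.innerL2 (fun _ _ ↦ 1) u = 0 ∧ 0 < Γ.normSqL2 u) :
    ∃ M : ℝ, 0 < M ∧ (∃ w : Γ.EdgeFun 𝕜, Γ.IsEigenfunction M⁻¹ w) ∧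
      ∀ (u u' : E → ℝ → 𝕜) (a : V → 𝕜), Γ.IsSobolev u u' a → Γ.innerL2 (fun _ _ ↦ 1) u = 0 →
        Γ.normSqL2 u ≤ M * Γ.normSqL2 u' := by
  set K := Γ.meanZeroPrimitive 𝕜 with hK
  have hpoincare : ∀ (u u' : E → ℝ → 𝕜) (a : V → 𝕜), Γ.IsSobolev u u' a →
      Γ.innerL2 (fun _ _ ↦ 1) u = 0 → Γ.normSqL2 u ≤ ‖K‖ ^ 2 * Γ.normSqL2 u' :=
    fun u u' a hu hmean ↦ by
      rw [← norm_sq_toL2 hu.memLp, ← norm_sq_toL2 hu.memLp_deriv, ← mul_pow,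
        ← hu.meanZeroPrimitive_deriv hΓ hmean]
      gcongr
      exact K.le_opNorm _
  have hK0 : K ≠ 0 := fun h ↦ by
    obtain ⟨u, u', a, hu, hmean, hpos⟩ := hex
    have := hpoincare u u' a hu hmean
    simp only [h, norm_zero] at this
    linarith
  have hM : 0 < ‖K‖ ^ 2 := by have := norm_pos_iff.2 hK0; positivity
  obtain ⟨g, hg0, hg⟩ := (isCompactOperator_meanZeroPrimitive 𝕜 Γ).exists_inner_apply_eq_norm_sq_mul
    K hK0
  have hM' : ((‖K‖ ^ 2 : ℝ) : 𝕜) ≠ 0 := by rw [Ne, RCLike.ofReal_eq_zero]; exact hM.ne'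
  -- `K` kills the orthogonal complement of the gradients, so the Euler-Lagrange equation makes `g`
  -- orthogonal to that complement.
  have hgm : g ∈ Γ.gradients 𝕜 := by
    rw [← Submodule.orthogonal_orthogonal (Γ.gradients 𝕜)]
    refine (Submodule.mem_orthogonal _ _).2 fun h hh ↦ ?_
    have h1 : K h = 0 := by
      simp [hK, meanZeroPrimitive, (Submodule.starProjection_apply_eq_zero_iff _).2 hh]
    have h2 := hg h
    rw [h1, inner_zero_left, eq_comm, mul_eq_zero] at h2
    exact h2.resolve_left hM'
  obtain ⟨m, hm⟩ := Submodule.mem_span_singleton.1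
    (show Γ.primitiveOperator 𝕜 g - K g ∈ 𝕜 ∙ Γ.oneL2 𝕜 by
      rw [hK, meanZeroPrimitive_of_mem hgm, Submodule.starProjection_orthogonal_val,
        sub_sub_cancel]
      exact Submodule.starProjection_apply_mem _ _)
  have hw := (isSobolev_primitive hgm).sub_const m
  set w₀ : E → ℝ → 𝕜 := fun e x ↦ Γ.primitive g e x - m with hw₀
  have hKg : K g = Γ.toL2 w₀ hw.memLp := by
    rw [toL2_sub_const (isSobolev_primitive hgm).memLp, hm, primitiveOperator_apply,
      sub_sub_cancel]
  have hwmean : Γ.innerL2 (fun _ _ ↦ 1) w₀ = 0 := by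
    rw [← inner_toL2 (fun _ ↦ memLp_const _) hw.memLp, ← hKg]
    exact inner_oneL2_meanZeroPrimitive g
  have hwpos : K g ≠ 0 := fun h ↦ by
    have h1 := hg g
    rw [h, inner_zero_left, eq_comm, mul_eq_zero] at h1
    exact hg0 (inner_self_eq_zero.1 (h1.resolve_left hM'))
  have hweak : ∀ (φ φ' : E → ℝ → 𝕜) (b : V → 𝕜), Γ.IsSobolev φ φ' b →
      Γ.innerL2 φ w₀ = ((‖K‖ ^ 2 : ℝ) : 𝕜) * Γ.innerL2 φ' fun e ↦ g e := fun φ φ' b hφ ↦ by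
    -- Removing the mean of the test function changes neither `φ'` nor its product with `w₀`, which
    -- has mean zero. Thus the equation holds for all test functions.
    obtain ⟨c, hmean⟩ := hΓ.exists_innerL2_one_sub_const_eq_zero hφ.memLp
    have hφc := hφ.sub_const c
    have h1 := hg (Γ.toL2 φ' hφ.memLp_deriv)
    rw [hφc.meanZeroPrimitive_deriv hΓ hmean, hKg, inner_toL2 hφc.memLp,
      innerL2_sub_left hw.memLp hφ.memLp (fun _ ↦ memLp_const _),
      innerL2_const_left_eq_zero hwmean, sub_zero] at h1
    rw [h1, ← inner_toL2 hφ.memLp_deriv hw.memLp_deriv, toL2_coeFn]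
  obtain ⟨w', w'', hae, hdd, heq, hk⟩ := hw.exists_deriv_two hM.ne' hweak
  refine ⟨‖K‖ ^ 2, hM, ⟨fun e x ↦ w₀ e x, fun h ↦ hwpos ?_, w', w'', ⟨fun e ↦ ?_, hdd, fun v ↦ ?_,
    hk⟩, fun e ↦ ?_⟩, hpoincare⟩
  · rw [hKg]
    refine (toL2_congr (g := fun _ _ ↦ 0) hw.memLp (fun _ ↦ memLp_const 0) fun e ↦ ?_).trans rfl
    filter_upwards [ae_restrict_mem measurableSet_Icc] with x hx
    exact congrFun (congrFun h e) ⟨x, hx⟩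
  · exact (hw.deriv e).congr (Γ.length_pos e).le (fun x hx ↦ onEdge_of_mem _ e hx) (hae e)
  · refine ⟨Γ.potential 𝕜 (Γ.edgeIntegrals 𝕜 g) v - m, fun e he ↦ ?_, fun e he ↦ ?_⟩
    · rw [onEdge_of_mem _ e ⟨le_rfl, (Γ.length_pos e).le⟩]
      exact (hw.start e).trans (by rw [he])
    · rw [onEdge_of_mem _ e ⟨(Γ.length_pos e).le, le_rfl⟩]
      exact (hw.finish e).trans (by rw [he])
  · filter_upwards [ae_restrict_mem measurableSet_Icc] with x hx
    rw [heq, onEdge_of_mem _ e hx]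

end Existence

end MetricGraph

/-! ### The eigenvalue of index one -/

namespace MetricGraph

variable {𝕜 : Type*} [RCLike 𝕜] {V E : Type*} [Fintype E] {Γ : MetricGraph V E}

theorem HasValueAt.unique {u : Γ.EdgeFun 𝕜} {v : V} {c d : 𝕜} (hc : Γ.HasValueAt u v c)
    (hd : Γ.HasValueAt u v d) : c = d := by
  obtain ⟨e, he | he⟩ := Γ.exists_edge v
  · exact (hc.1 e he).symm.trans (hd.1 e he)
  · exact (hc.2 e he).symm.trans (hd.2 e he)

/-- Eigenfunctions with nonzero eigenvalues have mean zero. -/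
theorem IsEigenfunction.innerL2_one_eq_zero {u : Γ.EdgeFun 𝕜} {ν : ℝ}
    (hu : Γ.IsEigenfunction ν u) (hν : ν ≠ 0) : Γ.innerL2 (fun _ _ ↦ 1) (Γ.onEdge u) = 0 := by
  obtain ⟨u', a, -, -, hw⟩ := hu.exists_isSobolev
  have h := hw _ _ _ (IsSobolev.const 1)
  have h0 : Γ.innerL2 (fun _ _ ↦ 0) u' = 0 := by simp [innerL2]
  rw [h0, mul_eq_zero] at h
  exact h.resolve_left (by simpa using hν)

theorem IsEigenfunction.exists_normSqL2_deriv {u : Γ.EdgeFun 𝕜} {ν : ℝ}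
    (hu : Γ.IsEigenfunction ν u) : ∃ (u' : E → ℝ → 𝕜) (a : V → 𝕜),
      Γ.IsSobolev (Γ.onEdge u) u' a ∧ (∀ v, Γ.HasValueAt u v (a v)) ∧
      ν * Γ.normSqL2 (Γ.onEdge u) = Γ.normSqL2 u' := by
  obtain ⟨u', a, hs, ha, hw⟩ := hu.exists_isSobolev
  have h := hw _ _ _ hs
  rw [innerL2_self, innerL2_self] at h
  exact ⟨u', a, hs, ha, by exact_mod_cast h⟩

theorem rank_spectralSpan_le_one {s : Set ℝ}
    (h : ∀ μ ∈ s, ∀ u : Γ.EdgeFun 𝕜, Γ.IsEigenfunction μ u → ∃ c, u = fun _ _ ↦ c) :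
    Module.rank 𝕜 (Γ.spectralSpan 𝕜 s) ≤ 1 := by
  have hle : Γ.spectralSpan 𝕜 s ≤ Submodule.span 𝕜 {(fun _ _ ↦ 1 : Γ.EdgeFun 𝕜)} := by
    refine Submodule.span_le.2 ?_
    rintro u ⟨μ, hμ, hu⟩
    obtain ⟨c, rfl⟩ := h μ hμ u hu
    exact Submodule.mem_span_singleton.2 ⟨c, by ext; simp⟩
  simpa using (Submodule.rank_mono hle).trans (rank_span_le _)

/-- Otherwise all eigenfunctions counted would be constant, spanning at most one dimension. -/
theorem IsNthEigenvalue.pos (hΓ : Γ.Connected) {ν : ℝ} (h : Γ.IsNthEigenvalue 𝕜 1 ν) : 0 < ν := by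
  by_contra! hν
  refine absurd h.2 (not_lt.2 ?_)
  rw [Nat.cast_one]
  exact rank_spectralSpan_le_one fun μ hμ u hu ↦
    hu.eq_const_of_nonpos hΓ (le_trans hμ hν)

/-- An eigenvalue which is the minimum of the Rayleigh quotient on the functions of mean zero is the
first one above the lowest. -/
theorem isNthEigenvalue_one_of_minimizer (hΓ : Γ.Connected) {M : ℝ} (hM : 0 < M)
    {w : Γ.EdgeFun 𝕜} (hw : Γ.IsEigenfunction M⁻¹ w)
    (hmin : ∀ (u u' : E → ℝ → 𝕜) (a : V → 𝕜), Γ.IsSobolev u u' a →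
      Γ.innerL2 (fun _ _ ↦ 1) u = 0 → Γ.normSqL2 u ≤ M * Γ.normSqL2 u') :
    Γ.IsNthEigenvalue 𝕜 1 M⁻¹ := by
  rw [IsNthEigenvalue, Nat.cast_one]
  constructor
  · refine rank_spectralSpan_le_one fun μ hμ u hu ↦ ?_
    obtain hμ0 | hμ0 := le_or_gt μ 0
    · exact hu.eq_const_of_nonpos hΓ hμ0
    -- For `0 < μ < M⁻¹` the Poincaré inequality gives `‖u‖² ≤ M μ ‖u‖² < ‖u‖²`.
    exfalso
    obtain ⟨u', a, hs, -, henergy⟩ := hu.exists_normSqL2_deriv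
    have h := hmin _ _ _ hs (hu.innerL2_one_eq_zero hμ0.ne')
    rw [← henergy, ← mul_assoc] at h
    have hpos := hs.normSqL2_onEdge_pos hu.1
    have hlt : M * μ < 1 := by
      have := mul_lt_mul_of_pos_left (Set.mem_Iio.1 hμ) hM
      rwa [mul_inv_cancel₀ hM.ne'] at this
    nlinarith
  · have h1 : (fun _ _ ↦ 1 : Γ.EdgeFun 𝕜) ∈ Γ.spectralSpan 𝕜 (Set.Iic M⁻¹) :=
      Submodule.subset_span ⟨0, (inv_pos.2 hM).le, isEigenfunction_zero_one hΓ⟩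
    have h2 : w ∈ Γ.spectralSpan 𝕜 (Set.Iic M⁻¹) := 
      Submodule.subset_span ⟨M⁻¹, Set.mem_Iic.2 le_rfl, hw⟩
    -- A multiple of the constant function cannot equal `w`, which is nonzero with mean zero.
    have hli : LinearIndependent 𝕜 ![(⟨_, h1⟩ : Γ.spectralSpan 𝕜 (Set.Iic M⁻¹)), ⟨w, h2⟩] := by
      rw [LinearIndependent.pair_iff' fun h ↦
        (isEigenfunction_zero_one hΓ).1 (congrArg Subtype.val h)]
      intro c hc
      have hwc : w = fun _ _ ↦ c := by
        have hc' : c • (fun _ _ ↦ 1 : Γ.EdgeFun 𝕜) = w := congrArg Subtype.val hc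
        rw [← hc']
        ext
        simp
      have hmean := hw.innerL2_one_eq_zero (inv_pos.2 hM).ne'
      have hconst : Γ.onEdge w = fun _ _ ↦ c := by rw [hwc]; rfl
      rw [hconst, innerL2_const_right, mul_eq_zero] at hmean
      refine hw.1 (hwc.trans ?_)
      rw [hmean.resolve_right hΓ.innerL2_one_one_ne_zero]
      rfl
    have h : (2 : Cardinal) ≤ Module.rank 𝕜 (Γ.spectralSpan 𝕜 (Set.Iic M⁻¹)) := by
      simpa using hli.cardinal_lift_le_rank
    exact lt_of_lt_of_le Cardinal.one_lt_two h

/-! ### Extension to the added edge -/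

section AddEdge

variable {V₁ V₂ : V} {ℓ : ℝ} {hℓ : 0 < ℓ}

/-- A function with equal values at `V₁` and `V₂` is extended by a constant to the new edge. -/
theorem IsSobolev.addEdge {u u' : E → ℝ → 𝕜} {a : V → 𝕜} (hu : Γ.IsSobolev u u' a)
    (h : a V₂ = a V₁) :
    (Γ.addEdge V₁ V₂ ℓ hℓ).IsSobolev (fun o ↦ o.elim (fun _ ↦ a V₁) u)
      (fun o ↦ o.elim (fun _ ↦ 0) u') a where
  deriv
    | none => HasSobolevDeriv.const _
    | some e => hu.deriv e
  start
    | none => rfl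
    | some e => hu.start e
  finish
    | none => h.symm
    | some e => hu.finish e

theorem normSqL2_addEdge (f : Option E → ℝ → 𝕜) :
    (Γ.addEdge V₁ V₂ ℓ hℓ).normSqL2 f =
      (∫ x in Set.Icc 0 ℓ, ‖f none x‖ ^ 2) + Γ.normSqL2 fun e ↦ f (some e) :=
  Fintype.sum_option _

end AddEdge

end MetricGraph

theorem theorem3 {𝕜 : Type*} [RCLike 𝕜] {V E : Type*} [Fintype E]
    (Γ : MetricGraph V E) (hΓ : Γ.Connected)
    (V₁ V₂ : V) (ℓ : ℝ) (hℓ : 0 < ℓ)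
    (lam₁ : ℝ) (hlam₁ : Γ.IsNthEigenvalue 𝕜 1 lam₁)
    (ψ₁ : Γ.EdgeFun 𝕜) (hψ₁ : Γ.IsEigenfunction lam₁ ψ₁)
    (c : 𝕜) (hV₁ : Γ.HasValueAt ψ₁ V₁ c) (hV₂ : Γ.HasValueAt ψ₁ V₂ c) :
    ∃ lam₁' : ℝ, (Γ.addEdge V₁ V₂ ℓ hℓ).IsNthEigenvalue 𝕜 1 lam₁' ∧ lam₁' ≤ lam₁ := by
  have hΓ' := hΓ.addEdge V₁ V₂ ℓ hℓ
  have hpos := hlam₁.pos hΓ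
  obtain ⟨u', a, hs, ha, henergy⟩ := hψ₁.exists_normSqL2_deriv
  have hψpos := hs.normSqL2_onEdge_pos hψ₁.1
  have hφ := hs.addEdge (hℓ := hℓ) (((ha V₂).unique hV₂).trans (hV₁.unique (ha V₁)))
  obtain ⟨m, hmean⟩ := hΓ'.exists_innerL2_one_sub_const_eq_zero hφ.memLp
  have hφm := hφ.sub_const m
  -- The mean `m` is taken over the enlarged graph. On the old edges subtracting it cannot decrease
  -- the norm, as `ψ₁` has mean zero there; the new edge contributes a nonnegative term.
  have hnorm : Γ.normSqL2 (Γ.onEdge ψ₁) ≤ (Γ.addEdge V₁ V₂ ℓ hℓ).normSqL2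
      (fun o x ↦ o.elim (fun _ ↦ a V₁) (Γ.onEdge ψ₁) x - m) := by
    rw [MetricGraph.normSqL2_addEdge]
    refine (MetricGraph.normSqL2_le_normSqL2_sub_const hs.memLp
      (hψ₁.innerL2_one_eq_zero hpos.ne') m).trans ?_
    exact le_add_of_nonneg_left (integral_nonneg fun _ ↦ by positivity)
  obtain ⟨M, hM, ⟨w, hw⟩, hmin⟩ := MetricGraph.exists_isEigenfunction_minimizer hΓ'
    ⟨_, _, _, hφm, hmean, hψpos.trans_le hnorm⟩
  refine ⟨M⁻¹, MetricGraph.isNthEigenvalue_one_of_minimizer hΓ' hM hw hmin, ?_⟩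
  -- Since the extension has no energy on the new edge, this gives `‖ψ₁‖² ≤ M lam₁ ‖ψ₁‖²`, hence `1
  -- ≤ M * lam₁`.
  have h := hnorm.trans (hmin _ _ _ hφm hmean)
  rw [MetricGraph.normSqL2_addEdge] at h
  simp only [Option.elim_none, Option.elim_some, norm_zero] at h
  rw [← henergy] at h
  have h' : 1 ≤ M * lam₁ := by
    refine le_of_mul_le_mul_right ?_ hψpos
    simpa [mul_assoc] using h
  rwa [inv_le_iff_one_le_mul₀' hM]
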